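/- Let $p\ge 0$, let $G=(V,E)$ be a graph on $V=\{1,\dots,p\}$ and let $\lambda>0$. The ferromagnetic Ising model on $G$ is the distribution on $\{-1,1\}^p$ given by $P_G(x)=\frac1Z\exp\big(\sum_{\{i,j\}\in E}\lambda x_ix_j\big)$, where every edge is counted once and $Z$ is the normalizing constant. A decoder maps a matrix $\mathbf X$ of $n$ independent samples from $P_G$ to a graph $\hat G=(V,\hat E)$ on the same vertex set. Let $\mathcal G_{k,d}$ be the class of all graphs on $V$ with at most $k$ edges and all degrees at most $d$, and, for a decoder and an integer $q\ge 0$, put $$P_e(q)=\max_{G\in\mathcal G_{k,d}}\mathbb P_G\big[|E\,\Delta\,\hat E|>q\big].$$ Write $H_2(t)=-t\log t-(1-t)\log(1-t)$, all logarithms being natural. **Theorem.** Let $\theta>0$ be a constant. There is a function $r=r_\theta:\mathbb R\to\mathbb R$ with $r(t)\to0$ as $t\to\infty$, and there are constants $c,C>0$ that depend only on $\theta$, such that the following holds for all integers $p,k,n\ge 0$ and $d>2$ with $\theta<\frac14\cdot\frac{d-2}{d}$ and $k\le p/4$, all $\lambda>0$, all real $\delta$ and all decoders based on $n$ samples. Put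 $q_{\max}=\lfloor\theta k\rfloor$. If $P_e(q_{\max})\le\delta$, then $$n\;\ge\;\max\left\{\frac{e^{\lambda(d-2)/4}\big(\log2-H_2\big(\tfrac{d}{d-2}\cdot2\theta\big)\big)}{3\lambda d^2},\ \frac{2(1-\theta)\log p}{\lambda\tanh\lambda}\right\}\Big(1-\delta-r\big(k/d^2\big)\Big).$$ In particular, if $k=\omega(d^2)$, so that $k/d^2\to\infty$, the term $r(k/d^2)$ is an $o(1)$ term, uniformly in $\lambda$, $n$, $\delta$ and the decoder. Consequently, under the same hypotheses, the sample complexity is exponential in $\lambda d$, $$n\ge C\,e^{c\lambda d}\,\big(1-\delta-r(k/d^2)\big),$$ and it is $\Omega(d^2\log p)$ when $\lambda=O(1/d)$: for every $B>0$, if moreover $\lambda\le B/d$, then $$n\ge\frac{2(1-\theta)}{B^2}\,d^2\log p\,\big(1-\delta-r(k/d^2)\big).$$ -/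

import Mathlib

open Filter Topology

noncomputable section

open scoped Classical in
/-- The interaction energy `∑_{(i,j) ∈ E} λ x_i x_j` of a spin configuration `x ∈ {-1,1}^p`.
Each (unordered) edge is counted once. -/
def isingEnergy {p : ℕ} (G : SimpleGraph (Fin p)) (lam : ℝ) (x : Fin p → ℤˣ) : ℝ :=
  ∑ i : Fin p, ∑ j : Fin p,
    if i < j ∧ G.Adj i j then lam * (((x i : ℤˣ) : ℤ) : ℝ) * (((x j : ℤˣ) : ℤ) : ℝ) else 0

/-- The partition function of the ferromagnetic Ising model on `G`. -/
def isingZ {p : ℕ} (G : SimpleGraph (Fin p)) (lam : ℝ) : ℝ :=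
  ∑ x : Fin p → ℤˣ, Real.exp (isingEnergy G lam x)

/-- The probability mass function `P_G` of the ferromagnetic Ising model on `G`. -/
def isingProb {p : ℕ} (G : SimpleGraph (Fin p)) (lam : ℝ) (x : Fin p → ℤˣ) : ℝ :=
  Real.exp (isingEnergy G lam x) / isingZ G lam

/-- The joint probability of `n` independent samples from `P_G`, the rows of `X`. -/
def sampleProb {p n : ℕ} (G : SimpleGraph (Fin p)) (lam : ℝ) (X : Fin n → Fin p → ℤˣ) : ℝ :=
  ∏ t : Fin n, isingProb G lam (X t)

/-- The edit distance `|E Δ E'|` between two graphs on the same vertex set. -/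
def editDist {p : ℕ} (G H : SimpleGraph (Fin p)) : ℕ :=
  (symmDiff G.edgeSet H.edgeSet).ncard

/-- The class `𝒢_{k,d}` of graphs on `p` vertices with at most `k` edges and all degrees at
most `d`. -/
def graphClass (p k d : ℕ) : Set (SimpleGraph (Fin p)) :=
  {G | G.edgeSet.ncard ≤ k ∧ ∀ v, (G.neighborSet v).ncard ≤ d}

/-- A decoder: it maps the `n` samples to an arbitrary graph on the `p` vertices. -/
abbrev Decoder (n p : ℕ) : Type := (Fin n → Fin p → ℤˣ) → SimpleGraph (Fin p)

open scoped Classical in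
/-- `ℙ_G[|E Δ Ê| > q]`, for `n` independent samples from `P_G`. -/
def errProb {p n : ℕ} (lam : ℝ) (q : ℕ) (dec : Decoder n p) (G : SimpleGraph (Fin p)) : ℝ :=
  ∑ X : Fin n → Fin p → ℤˣ, if q < editDist G (dec X) then sampleProb G lam X else 0

/-- The worst-case error probability `P_e(q) = max_{G ∈ 𝒢_{k,d}} ℙ_G[|E Δ Ê| > q]`.
The class is finite and contains the empty graph, so that the supremum is a maximum. -/
def worstErrProb {p n : ℕ} (k d : ℕ) (lam : ℝ) (q : ℕ) (dec : Decoder n p) : ℝ :=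
  ⨆ G : graphClass p k d, errProb lam q dec (G : SimpleGraph (Fin p))

end

/-!
Both lower bounds come from Fano's inequality for approximate recovery. If graphs `G_a`, `a ∈ T`,
have divergence at most `D` from one reference model, and at most `|T| e^{-L}` of them lie within
edit distance `q` of any one graph, then a decoder with error probability at most `δ` needs
`(1 - δ) L ≤ n D + log 2` (`fano_ising`). Two ensembles are used.

* Matchings. Each of `k` left vertices is joined to its own vertex among the other `p - k`. There are
  at least `(p / 2) ^ k` of them, of which at most `2 ^ k p ^ q` share a ball of radius `q`, so that
  `L` is about `(1 - θ) k log p`. The reference is the empty graph, with divergence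
  `k (λ tanh λ - log cosh λ) ≤ k λ tanh λ / 2`; subtracting `log cosh λ` is what yields the factor
  `2` in front of `log p / (λ tanh λ)`. This gives `sample_bound_of_matchings`.

* Cliques of `d + 1` vertices with unreliable edges. About `2 k / (d (d + 1))` disjoint blocks are
  formed, and in each of them a hub of `⌊(d + 1) / 4⌋` vertices is joined to the whole block. The
  remaining `N ≥ k (d - 2) / (2 d)` edges are free, and each subset of them gives a graph of the
  ensemble. By the Hamming bound `L` is `N (log 2 - H_2(t))` with `t = 2 θ d / (d - 2)`, since
  `q ≤ t N`. The hub alone already makes the spins of a block agree with high probability: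
  reversing the minority set `S` gains energy at least `λ m |S|` for a hub of `m` vertices
  (`isingEnergy_flipOn_ge`), and a union bound over `S` gives a disagreement probability of order
  `d e^{-λ m}` (`disagreeProb_le_two_mul`). Hence a free edge contributes at most of order
  `λ d e^{-λ (d - 2) / 4}` to the divergence from the graph of hubs. This gives `sample_bound_exp`.

For fixed `θ` the deficit `log 2 - H_2(t)` is bounded below uniformly in `d` (`exists_entropy_gap`),
so that the additive losses in both bounds are relative losses that vanish as `k / d ^ 2 → ∞`. The
exponential bound needs both estimates, since the first one alone loses a polynomial factor in `d`
(`exp_le_max_bounds`); the bound for `λ ≤ B / d` is the second estimate with `tanh λ ≤ λ`.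
-/

/-! ### Fano's inequality for approximate recovery -/

/-- Fano's inequality for approximate recovery. It is the variational bound
`∑ P f ≤ D(P ‖ Q) + log ∑ Q e^f` for `f = L 1_A`, averaged over the ensemble; the hypothesis `hcard`
keeps the averaged exponential moment under `Q` at most `2`. -/
theorem fano_approximate {ι Ω : Type*} [Fintype Ω] (T : Finset ι) (P : ι → Ω → ℝ) (Q : Ω → ℝ)
    (A : ι → Ω → Prop) [∀ a ω, Decidable (A a ω)] {L D δ : ℝ}
    (hT : T.Nonempty) (hP : ∀ a ∈ T, ∀ ω, 0 < P a ω) (hP1 : ∀ a ∈ T, ∑ ω, P a ω = 1)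
    (hQ : ∀ ω, 0 < Q ω) (hQ1 : ∑ ω, Q ω = 1) (hL : 0 ≤ L)
    (hcard : ∀ ω, ((T.filter (A · ω)).card : ℝ) * Real.exp L ≤ T.card)
    (hD : ∀ a ∈ T, ∑ ω, P a ω * Real.log (P a ω / Q ω) ≤ D)
    (hA : ∀ a ∈ T, 1 - δ ≤ ∑ ω, if A a ω then P a ω else 0) :
    (1 - δ) * L ≤ D + Real.log 2 := by
  have hTc : (0 : ℝ) < T.card := by exact_mod_cast hT.card_pos
  have key : ∀ a ∈ T, (1 - δ) * L - D ≤
      2⁻¹ * (∑ ω, Q ω * Real.exp (if A a ω then L else 0)) - 1 + Real.log 2 := by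
    intro a ha
    have h1 : ∀ ω, P a ω * ((if A a ω then L else 0) - Real.log (P a ω / Q ω)) ≤
        2⁻¹ * (Q ω * Real.exp (if A a ω then L else 0)) - P a ω + P a ω * Real.log 2 := by
      intro ω
      have hp := hP a ha ω
      have hq := hQ ω
      set f : ℝ := if A a ω then L else 0
      -- the tangent line of `log` at `2`
      have h2 := Real.log_le_sub_one_of_pos
        (show 0 < Q ω * Real.exp f / (2 * P a ω) by positivity)
      have h3 : Real.log (Q ω * Real.exp f / (2 * P a ω)) =
          f - Real.log (P a ω / Q ω) - Real.log 2 := by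
        rw [Real.log_div (by positivity) (by positivity), Real.log_mul (by positivity)
          (by positivity), Real.log_exp, Real.log_mul (by positivity) (by positivity),
          Real.log_div (by positivity) (by positivity)]
        ring
      rw [h3] at h2
      have h4 : P a ω * (Q ω * Real.exp f / (2 * P a ω)) = 2⁻¹ * (Q ω * Real.exp f) := by
        field_simp
      nlinarith [mul_le_mul_of_nonneg_left h2 hp.le]
    have h2 := Finset.sum_le_sum (fun ω (_ : ω ∈ Finset.univ) => h1 ω)
    simp only [Finset.sum_add_distrib, Finset.sum_sub_distrib, ← Finset.mul_sum,
      ← Finset.sum_mul, hP1 a ha, mul_sub, one_mul] at h2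
    have h3 : ∑ ω, P a ω * (if A a ω then L else 0) = (∑ ω, if A a ω then P a ω else 0) * L := by
      rw [Finset.sum_mul]
      refine Finset.sum_congr rfl fun ω _ => ?_
      split_ifs <;> simp
    have h4 := mul_le_mul_of_nonneg_right (hA a ha) hL
    have h5 := hD a ha
    rw [h3] at h2
    linarith
  have hsum := Finset.sum_le_sum key
  simp only [Finset.sum_add_distrib, Finset.sum_sub_distrib, ← Finset.mul_sum, Finset.sum_const,
    nsmul_eq_mul, mul_one] at hsum
  have hav : ∑ a ∈ T, ∑ ω, Q ω * Real.exp (if A a ω then L else 0) ≤ 2 * T.card := by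
    rw [Finset.sum_comm]
    have h1 : ∀ ω, ∑ a ∈ T, Q ω * Real.exp (if A a ω then L else 0) ≤ Q ω * (2 * T.card) := by
      intro ω
      rw [← Finset.mul_sum]
      refine mul_le_mul_of_nonneg_left ?_ (hQ ω).le
      have h2 : ∑ a ∈ T, Real.exp (if A a ω then L else 0) ≤
          ∑ a ∈ T, ((if A a ω then Real.exp L else 0) + 1) := by
        refine Finset.sum_le_sum fun a _ => ?_
        split_ifs <;> simp
      refine h2.trans ?_
      rw [Finset.sum_add_distrib, ← Finset.sum_filter, Finset.sum_const, Finset.sum_const,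
        nsmul_eq_mul, nsmul_eq_mul]
      linarith [hcard ω]
    refine (Finset.sum_le_sum fun ω _ => h1 ω).trans ?_
    rw [← Finset.sum_mul, hQ1, one_mul]
  have : (T.card : ℝ) * ((1 - δ) * L - D) ≤ T.card * Real.log 2 := by linarith
  linarith [le_of_mul_le_mul_left this hTc]

/-! ### Ising distribution and product sampling -/

theorem isingZ_pos {p : ℕ} (G : SimpleGraph (Fin p)) (lam : ℝ) : 0 < isingZ G lam :=
  Finset.sum_pos (fun _ _ => Real.exp_pos _) Finset.univ_nonempty

theorem isingProb_pos {p : ℕ} (G : SimpleGraph (Fin p)) (lam : ℝ) (x : Fin p → ℤˣ) :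
    0 < isingProb G lam x :=
  div_pos (Real.exp_pos _) (isingZ_pos G lam)

theorem sum_isingProb {p : ℕ} (G : SimpleGraph (Fin p)) (lam : ℝ) :
    ∑ x, isingProb G lam x = 1 := by
  simp only [isingProb, ← Finset.sum_div]
  exact div_self (isingZ_pos G lam).ne'

theorem sampleProb_pos {p n : ℕ} (G : SimpleGraph (Fin p)) (lam : ℝ) (X : Fin n → Fin p → ℤˣ) :
    0 < sampleProb G lam X :=
  Finset.prod_pos fun _ _ => isingProb_pos G lam _

theorem sum_sampleProb {p n : ℕ} (G : SimpleGraph (Fin p)) (lam : ℝ) :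
    ∑ X : Fin n → Fin p → ℤˣ, sampleProb G lam X = 1 := by
  simp only [sampleProb]
  rw [← Fintype.prod_sum (fun (_ : Fin n) x => isingProb G lam x)]
  simp [sum_isingProb]

theorem sum_sampleProb_mul_apply {p n : ℕ} (G : SimpleGraph (Fin p)) (lam : ℝ)
    (g : (Fin p → ℤˣ) → ℝ) (t : Fin n) :
    ∑ X : Fin n → Fin p → ℤˣ, sampleProb G lam X * g (X t) = ∑ x, isingProb G lam x * g x := by
  have h1 : ∀ X : Fin n → Fin p → ℤˣ, sampleProb G lam X * g (X t) =
      ∏ s, (isingProb G lam (X s) * if s = t then g (X s) else 1) := by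
    intro X
    rw [Finset.prod_mul_distrib, sampleProb, Finset.prod_ite_eq' Finset.univ t]
    simp
  simp only [h1]
  rw [← Fintype.prod_sum (fun (s : Fin n) x => isingProb G lam x * if s = t then g x else 1),
    Finset.prod_eq_single t]
  · simp
  · intro s _ hs
    simp [hs, sum_isingProb]
  · simp

/-- The Kullback–Leibler divergence `D(P_G ‖ P_H)` of two Ising models, in nats. -/
noncomputable def isingKL {p : ℕ} (G H : SimpleGraph (Fin p)) (lam : ℝ) : ℝ :=
  ∑ x, isingProb G lam x * Real.log (isingProb G lam x / isingProb H lam x)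

/-- The divergence of `n` independent samples is `n` times that of one sample. -/
theorem sum_sampleProb_mul_log {p n : ℕ} (G H : SimpleGraph (Fin p)) (lam : ℝ) :
    ∑ X : Fin n → Fin p → ℤˣ,
      sampleProb G lam X * Real.log (sampleProb G lam X / sampleProb H lam X) =
      n * isingKL G H lam := by
  have h1 : ∀ X : Fin n → Fin p → ℤˣ, Real.log (sampleProb G lam X / sampleProb H lam X) =
      ∑ t, Real.log (isingProb G lam (X t) / isingProb H lam (X t)) := by
    intro X
    rw [sampleProb, sampleProb, ← Finset.prod_div_distrib, Real.log_prod]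
    exact fun t _ => (div_pos (isingProb_pos G lam _) (isingProb_pos H lam _)).ne'
  simp only [h1, Finset.mul_sum]
  rw [Finset.sum_comm]
  have h2 : ∀ t : Fin n, ∑ X : Fin n → Fin p → ℤˣ,
      sampleProb G lam X * Real.log (isingProb G lam (X t) / isingProb H lam (X t)) =
      isingKL G H lam := fun t =>
    sum_sampleProb_mul_apply G lam
      (fun x => Real.log (isingProb G lam x / isingProb H lam x)) t
  simp [h2]

theorem errProb_nonneg {p n : ℕ} (lam : ℝ) (q : ℕ) (dec : Decoder n p) (G : SimpleGraph (Fin p)) :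
    0 ≤ errProb lam q dec G :=
  Finset.sum_nonneg fun X _ => by
    split_ifs
    exacts [(sampleProb_pos G lam X).le, le_rfl]

theorem errProb_le_worstErrProb {p n k d : ℕ} (lam : ℝ) (q : ℕ) (dec : Decoder n p)
    {G : SimpleGraph (Fin p)} (hG : G ∈ graphClass p k d) :
    errProb lam q dec G ≤ worstErrProb k d lam q dec :=
  le_ciSup (f := fun G : graphClass p k d => errProb lam q dec (G : SimpleGraph (Fin p)))
    (Set.finite_range _).bddAbove ⟨G, hG⟩

theorem worstErrProb_nonneg {p n k d : ℕ} (lam : ℝ) (q : ℕ) (dec : Decoder n p) :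
    0 ≤ worstErrProb k d lam q dec :=
  Real.iSup_nonneg fun _ => errProb_nonneg lam q dec _

open scoped Classical in
/-- Fano's inequality for a decoder with worst-case error probability at most `δ`. -/
theorem fano_ising {p n k d q : ℕ} {lam δ L D : ℝ} {dec : Decoder n p}
    (hδ : worstErrProb k d lam q dec ≤ δ) {ι : Type*} (T : Finset ι) (hT : T.Nonempty)
    (G : ι → SimpleGraph (Fin p)) (G₀ : SimpleGraph (Fin p))
    (hG : ∀ a ∈ T, G a ∈ graphClass p k d) (hD : ∀ a ∈ T, isingKL (G a) G₀ lam ≤ D) (hL : 0 ≤ L)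
    (hcard : ∀ H : SimpleGraph (Fin p),
      ((T.filter fun a => editDist (G a) H ≤ q).card : ℝ) * Real.exp L ≤ T.card) :
    (1 - δ) * L ≤ n * D + Real.log 2 := by
  refine fano_approximate T (fun a X => sampleProb (G a) lam X)
    (fun X : Fin n → Fin p → ℤˣ => sampleProb G₀ lam X)
    (fun a X => editDist (G a) (dec X) ≤ q) hT (fun a _ => sampleProb_pos _ _)
    (fun a _ => sum_sampleProb _ _) (sampleProb_pos _ _) (sum_sampleProb _ _) hL
    (fun X => hcard (dec X)) ?_ ?_
  · intro a ha
    rw [sum_sampleProb_mul_log]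
    exact mul_le_mul_of_nonneg_left (hD a ha) (Nat.cast_nonneg n)
  · intro a ha
    have h1 := (errProb_le_worstErrProb lam q dec (hG a ha)).trans hδ
    have h2 : errProb lam q dec (G a) + (∑ X : Fin n → Fin p → ℤˣ,
        if editDist (G a) (dec X) ≤ q then sampleProb (G a) lam X else 0) = 1 := by
      rw [errProb, ← Finset.sum_add_distrib, ← sum_sampleProb (n := n) (G a) lam]
      refine Finset.sum_congr rfl fun X _ => ?_
      by_cases h : editDist (G a) (dec X) ≤ q
      · simp [h, not_lt.2 h]
      · simp [h, not_le.1 h]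
    linarith

/-! ### Energy as a sum over edges -/

/-- The edge set of a graph on `Fin p` as a `Finset`. -/
noncomputable def edges {p : ℕ} (G : SimpleGraph (Fin p)) : Finset (Sym2 (Fin p)) :=
  (Set.toFinite G.edgeSet).toFinset

@[simp]
theorem mem_edges {p : ℕ} {G : SimpleGraph (Fin p)} {e : Sym2 (Fin p)} :
    e ∈ edges G ↔ e ∈ G.edgeSet := by
  simp [edges]

theorem card_edges {p : ℕ} (G : SimpleGraph (Fin p)) : (edges G).card = G.edgeSet.ncard :=
  (Set.ncard_eq_toFinset_card _ _).symm

open scoped Classical in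
theorem editDist_eq_card {p : ℕ} (G H : SimpleGraph (Fin p)) :
    editDist G H = (symmDiff (edges G) (edges H)).card := by
  rw [editDist, ← Set.ncard_coe_finset]
  congr 1
  ext e
  simp [Set.mem_symmDiff]

/-- The product `x_i x_j` of the two spins at the ends of `e = {i, j}`. -/
noncomputable def spinProd {p : ℕ} (x : Fin p → ℤˣ) : Sym2 (Fin p) → ℝ :=
  Sym2.lift ⟨fun i j => (((x i : ℤˣ) : ℤ) : ℝ) * (((x j : ℤˣ) : ℤ) : ℝ), fun _ _ => mul_comm _ _⟩

theorem spinProd_mk {p : ℕ} (x : Fin p → ℤˣ) (i j : Fin p) :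
    spinProd x s(i, j) = (((x i * x j : ℤˣ) : ℤ) : ℝ) := by
  simp [spinProd]

theorem spinProd_mk_eq_ite {p : ℕ} (x : Fin p → ℤˣ) (i j : Fin p) :
    spinProd x s(i, j) = if x i ≠ x j then -1 else 1 := by
  rw [spinProd_mk]
  rcases Int.units_eq_one_or (x i) with h | h <;> rcases Int.units_eq_one_or (x j) with h' | h' <;>
    simp [h, h']

theorem spinProd_le_one {p : ℕ} (x : Fin p → ℤˣ) (e : Sym2 (Fin p)) : spinProd x e ≤ 1 := by
  induction e using Sym2.ind with
  | _ i j => rw [spinProd_mk_eq_ite]; split_ifs <;> norm_num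

theorem isingEnergy_eq_sum_edges {p : ℕ} (G : SimpleGraph (Fin p)) (lam : ℝ) (x : Fin p → ℤˣ) :
    isingEnergy G lam x = lam * ∑ e ∈ edges G, spinProd x e := by
  classical
  rw [isingEnergy, ← Finset.sum_product', ← Finset.sum_filter, Finset.mul_sum]
  refine Finset.sum_bij (fun ij _ => s(ij.1, ij.2)) ?_ ?_ ?_ ?_
  · rintro ⟨i, j⟩ h
    simp only [Finset.mem_filter] at h
    simpa using h.2.2
  · rintro ⟨i, j⟩ h ⟨i', j'⟩ h' heq
    simp only [Finset.mem_filter] at h h'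
    rcases Sym2.eq_iff.1 heq with ⟨h1, h2⟩ | ⟨h1, h2⟩
    · simp_all
    · simp only at h1 h2
      subst h1 h2
      exact absurd h.2.1 (not_lt.2 h'.2.1.le)
  · intro e he
    induction e using Sym2.ind with
    | _ i j =>
      have hadj : G.Adj i j := by simpa using he
      rcases lt_or_gt_of_ne hadj.ne with hlt | hlt
      · exact ⟨(i, j), by simp [hlt, hadj], rfl⟩
      · exact ⟨(j, i), by simp [hlt, hadj.symm], Sym2.eq_swap⟩
  · rintro ⟨i, j⟩ _
    simp [spinProd_mk, mul_assoc]

/-! ### Divergence between nested Ising models -/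

theorem log_isingProb_div {p : ℕ} (G H : SimpleGraph (Fin p)) (lam : ℝ) (x : Fin p → ℤˣ) :
    Real.log (isingProb G lam x / isingProb H lam x) =
      isingEnergy G lam x - isingEnergy H lam x -
        (Real.log (isingZ G lam) - Real.log (isingZ H lam)) := by
  rw [Real.log_div (isingProb_pos _ _ _).ne' (isingProb_pos _ _ _).ne', isingProb, isingProb,
    Real.log_div (Real.exp_ne_zero _) (isingZ_pos _ _).ne',
    Real.log_div (Real.exp_ne_zero _) (isingZ_pos _ _).ne', Real.log_exp, Real.log_exp]
  ring

theorem isingKL_eq {p : ℕ} (G H : SimpleGraph (Fin p)) (lam : ℝ) :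
    isingKL G H lam = ∑ x, isingProb G lam x * (isingEnergy G lam x - isingEnergy H lam x) -
      (Real.log (isingZ G lam) - Real.log (isingZ H lam)) := by
  simp only [isingKL, log_isingProb_div, mul_sub, Finset.sum_sub_distrib, ← Finset.sum_mul,
    sum_isingProb, one_mul]

/-- The divergence is at most its symmetrization, in which the partition functions cancel. -/
theorem isingKL_le_sum {p : ℕ} (G H : SimpleGraph (Fin p)) (lam : ℝ) :
    isingKL G H lam ≤ ∑ x, isingProb G lam x * (isingEnergy G lam x - isingEnergy H lam x) -
      ∑ x, isingProb H lam x * (isingEnergy G lam x - isingEnergy H lam x) := by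
  have h1 : ∑ x, isingProb H lam x * Real.log (isingProb G lam x / isingProb H lam x) ≤ 0 := by
    have h2 : ∀ x, isingProb H lam x * Real.log (isingProb G lam x / isingProb H lam x) ≤
        isingProb G lam x - isingProb H lam x := by
      intro x
      have hG := isingProb_pos G lam x
      have hH := isingProb_pos H lam x
      have h3 := mul_le_mul_of_nonneg_left (Real.log_le_sub_one_of_pos (div_pos hG hH)) hH.le
      rwa [mul_sub, mul_div_cancel₀ _ hH.ne', mul_one] at h3
    refine (Finset.sum_le_sum fun x _ => h2 x).trans ?_
    rw [Finset.sum_sub_distrib, sum_isingProb, sum_isingProb, sub_self]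
  simp only [log_isingProb_div, mul_sub _ _ (Real.log _ - _), Finset.sum_sub_distrib,
    ← Finset.sum_mul, sum_isingProb, one_mul] at h1
  rw [isingKL_eq]
  linarith

/-- The probability under `P_G` that the spins at `i` and `j` differ. -/
noncomputable def disagreeProb {p : ℕ} (G : SimpleGraph (Fin p)) (lam : ℝ) (i j : Fin p) : ℝ :=
  ∑ x : Fin p → ℤˣ, if x i ≠ x j then isingProb G lam x else 0

theorem sum_isingProb_mul_spinProd {p : ℕ} (G : SimpleGraph (Fin p)) (lam : ℝ) (i j : Fin p) :
    ∑ x, isingProb G lam x * spinProd x s(i, j) = 1 - 2 * disagreeProb G lam i j := by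
  rw [← sum_isingProb G lam, disagreeProb, Finset.mul_sum, ← Finset.sum_sub_distrib]
  refine Finset.sum_congr rfl fun x _ => ?_
  rw [spinProd_mk_eq_ite]
  split_ifs <;> ring

/-- Adding edges `A` whose ends already agree with high probability changes the model little: each
such edge has mean energy at most `λ` in the larger model and at least `λ (1 - 2 ε)` in the
smaller one. -/
theorem isingKL_le_of_disagreeProb_le {p : ℕ} {G G₀ : SimpleGraph (Fin p)} {lam ε : ℝ}
    (hlam : 0 ≤ lam) (A : Finset (Sym2 (Fin p))) (hGA : edges G = edges G₀ ∪ A)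
    (hA : Disjoint (edges G₀) A) (hε : ∀ i j, s(i, j) ∈ A → disagreeProb G₀ lam i j ≤ ε) :
    isingKL G G₀ lam ≤ A.card * (2 * lam * ε) := by
  have hE : ∀ x, isingEnergy G lam x - isingEnergy G₀ lam x = lam * ∑ e ∈ A, spinProd x e := by
    intro x
    rw [isingEnergy_eq_sum_edges, isingEnergy_eq_sum_edges, hGA, Finset.sum_union hA]
    ring
  refine (isingKL_le_sum G G₀ lam).trans ?_
  simp only [hE]
  have h1 : ∑ x, isingProb G lam x * (lam * ∑ e ∈ A, spinProd x e) ≤ lam * A.card := by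
    have h2 : ∀ x, isingProb G lam x * (lam * ∑ e ∈ A, spinProd x e) ≤
        isingProb G lam x * (lam * A.card) := by
      intro x
      refine mul_le_mul_of_nonneg_left (mul_le_mul_of_nonneg_left ?_ hlam)
        (isingProb_pos G lam x).le
      simpa using Finset.sum_le_card_nsmul A _ 1 fun e _ => spinProd_le_one x e
    refine (Finset.sum_le_sum fun x _ => h2 x).trans ?_
    rw [← Finset.sum_mul, sum_isingProb, one_mul]
  have h3 : ∑ x, isingProb G₀ lam x * (lam * ∑ e ∈ A, spinProd x e) =
      lam * ∑ e ∈ A, ∑ x, isingProb G₀ lam x * spinProd x e := by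
    rw [Finset.sum_comm, Finset.mul_sum]
    refine Finset.sum_congr rfl fun x _ => ?_
    rw [← Finset.mul_sum]
    ring
  have h4 : A.card * (1 - 2 * ε) ≤ ∑ e ∈ A, ∑ x, isingProb G₀ lam x * spinProd x e := by
    rw [← nsmul_eq_mul]
    refine Finset.card_nsmul_le_sum A _ _ fun e he => ?_
    induction e using Sym2.ind with
    | _ i j =>
      rw [sum_isingProb_mul_spinProd]
      linarith [hε i j he]
  have h5 := mul_le_mul_of_nonneg_left h4 hlam
  rw [h3]
  linarith

/-! ### Disagreement inside a block with a hub -/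

/-- The configuration obtained from `x` by reversing the spins in `S`. -/
def flipOn {p : ℕ} (S : Finset (Fin p)) (x : Fin p → ℤˣ) : Fin p → ℤˣ :=
  fun v => if v ∈ S then -x v else x v

theorem flipOn_involutive {p : ℕ} (S : Finset (Fin p)) : Function.Involutive (flipOn S) := by
  intro x
  funext v
  by_cases h : v ∈ S <;> simp [flipOn, h]

/-- Let `M ⊆ W` be joined to all of `W`, with no edge leaving `W`, and let `x` be constant on `S`
and on `W \ S`, with opposite signs. If `S` is at most half of `W`, then at least
`|M| |S| / 2` edges are cut by `S`, and reversing `S` raises the product of spins on each from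
`-1` to `1`. -/
theorem isingEnergy_flipOn_ge {p : ℕ} {G : SimpleGraph (Fin p)} {lam : ℝ} (hlam : 0 ≤ lam)
    {W M S : Finset (Fin p)} (hM : M ⊆ W)
    (hadj : ∀ i ∈ M, ∀ j ∈ W, i ≠ j → G.Adj i j) (hclosed : ∀ i ∈ W, ∀ j, G.Adj i j → j ∈ W)
    (hS : S ⊆ W) (hcard : 2 * S.card ≤ W.card) {x : Fin p → ℤˣ}
    (hx : ∀ i ∈ S, ∀ j ∈ W, j ∉ S → x i ≠ x j) :
    isingEnergy G lam x + lam * (M.card * S.card) ≤ isingEnergy G lam (flipOn S x) := by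
  classical
  have hcut : ∀ i ∈ S, ∀ j ∈ W, j ∉ S →
      spinProd (flipOn S x) s(i, j) - spinProd x s(i, j) = 2 := by
    intro i hi j hj hjS
    have h1 : -x i = x j := by
      have := hx i hi j hj hjS
      rcases Int.units_eq_one_or (x i) with h | h <;>
        rcases Int.units_eq_one_or (x j) with h' | h' <;> simp_all
    rw [spinProd_mk_eq_ite, spinProd_mk_eq_ite, if_pos (hx i hi j hj hjS)]
    simp [flipOn, hi, hjS, h1]
    norm_num
  have hnonneg : ∀ e ∈ edges G, 0 ≤ spinProd (flipOn S x) e - spinProd x e := by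
    intro e he
    induction e using Sym2.ind with
    | _ i j =>
      have hij : G.Adj i j := by simpa using he
      by_cases hi : i ∈ S <;> by_cases hj : j ∈ S
      · simp [spinProd_mk, flipOn, hi, hj]
      · rw [hcut i hi j (hclosed i (hS hi) j hij) hj]
        norm_num
      · rw [Sym2.eq_swap, hcut j hj i (hclosed j (hS hj) i hij.symm) hi]
        norm_num
      · simp [spinProd_mk, flipOn, hi, hj]
  -- A complete bipartite piece of the cut, spanned by the hub vertices on one side of it.
  have hpiece : ∀ X Y : Finset (Fin p), X ⊆ S → Y ⊆ W \ S → (X ⊆ M ∨ Y ⊆ M) →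
      2 * (X.card * Y.card : ℝ) ≤
        ∑ e ∈ edges G, (spinProd (flipOn S x) e - spinProd x e) := by
    intro X Y hX hY hXY
    have hinj : Set.InjOn (fun ij : Fin p × Fin p => s(ij.1, ij.2)) (X ×ˢ Y : Finset _) := by
      rintro ⟨i, j⟩ h ⟨i', j'⟩ h' heq
      simp only [Finset.coe_product, Set.mem_prod, Finset.mem_coe] at h h'
      rcases Sym2.eq_iff.1 heq with ⟨h1, h2⟩ | ⟨h1, h2⟩
      · simp_all
      · simp only at h1 h2
        subst h1 h2
        exact absurd (hX h.1) (Finset.mem_sdiff.1 (hY h'.2)).2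
    have hsub : (X ×ˢ Y).image (fun ij : Fin p × Fin p => s(ij.1, ij.2)) ⊆ edges G := by
      intro e he
      obtain ⟨⟨i, j⟩, hij, rfl⟩ := Finset.mem_image.1 he
      obtain ⟨hi, hj⟩ := Finset.mem_product.1 hij
      have hjW := Finset.mem_sdiff.1 (hY hj)
      have hne : i ≠ j := fun h => hjW.2 (h ▸ hX hi)
      simp only [mem_edges, SimpleGraph.mem_edgeSet]
      rcases hXY with h | h
      · exact hadj i (h hi) j hjW.1 hne
      · exact (hadj j (h hj) i (hS (hX hi)) hne.symm).symm
    refine le_trans (le_of_eq ?_) (Finset.sum_le_sum_of_subset_of_nonneg hsub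
      fun e he _ => hnonneg e he)
    rw [Finset.sum_image hinj, Finset.sum_congr rfl (g := fun _ => (2 : ℝ))]
    · simp
      ring
    · rintro ⟨i, j⟩ hij
      obtain ⟨hi, hj⟩ := Finset.mem_product.1 hij
      have hjW := Finset.mem_sdiff.1 (hY hj)
      exact hcut i (hX hi) j hjW.1 hjW.2
  have h1 := hpiece (M ∩ S) (W \ S) Finset.inter_subset_right subset_rfl
    (Or.inl Finset.inter_subset_left)
  have h2 := hpiece S (M \ S) subset_rfl (Finset.sdiff_subset_sdiff hM subset_rfl)
    (Or.inr Finset.sdiff_subset)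
  have h3 : ((M ∩ S).card : ℝ) + (M \ S).card = M.card := by
    exact_mod_cast Finset.card_inter_add_card_sdiff M S
  have h4 : (S.card : ℝ) ≤ (W \ S).card := by
    rw [Finset.card_sdiff_of_subset hS]
    exact_mod_cast (by omega : S.card ≤ W.card - S.card)
  have h5 : (M.card * S.card : ℝ) ≤
      ∑ e ∈ edges G, (spinProd (flipOn S x) e - spinProd x e) := by
    have h6 := mul_le_mul_of_nonneg_left h4 (Nat.cast_nonneg (α := ℝ) (M ∩ S).card)
    rw [← h3]
    linarith
  have h7 := mul_le_mul_of_nonneg_left h5 hlam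
  rw [Finset.sum_sub_distrib] at h7
  rw [isingEnergy_eq_sum_edges, isingEnergy_eq_sum_edges]
  linarith

/-- A union bound over the minority set `S` of a configuration in the block `W`. -/
theorem disagreeProb_le {p : ℕ} {G : SimpleGraph (Fin p)} {lam : ℝ} (hlam : 0 ≤ lam)
    {W M : Finset (Fin p)} (hM : M ⊆ W)
    (hadj : ∀ i ∈ M, ∀ j ∈ W, i ≠ j → G.Adj i j) (hclosed : ∀ i ∈ W, ∀ j, G.Adj i j → j ∈ W)
    {i j : Fin p} (hi : i ∈ W) (hj : j ∈ W) :
    disagreeProb G lam i j ≤ (1 + Real.exp (-(lam * M.card))) ^ W.card - 1 := by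
  classical
  set ε := Real.exp (-(lam * M.card)) with hε
  have hε0 : 0 < ε := Real.exp_pos _
  have hpt : ∀ x : Fin p → ℤˣ, (if x i ≠ x j then isingProb G lam x else 0) ≤
      ∑ S ∈ W.powerset.erase ∅, ε ^ S.card * isingProb G lam (flipOn S x) := by
    intro x
    have hnn : ∀ S ∈ W.powerset.erase ∅, 0 ≤ ε ^ S.card * isingProb G lam (flipOn S x) :=
      fun S _ => mul_nonneg (pow_nonneg hε0.le _) (isingProb_pos G lam _).le
    split_ifs with hne
    swap
    · exact Finset.sum_nonneg hnn
    have hmain : ∀ s : ℤˣ, 2 * (W.filter (x · = s)).card ≤ W.card →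
        (∃ v ∈ W, x v = s) → isingProb G lam x ≤
        ∑ S ∈ W.powerset.erase ∅, ε ^ S.card * isingProb G lam (flipOn S x) := by
      rintro s hs ⟨v, hv, hvs⟩
      set S := W.filter (x · = s) with hSdef
      have hS : S ∈ W.powerset.erase ∅ := by
        rw [Finset.mem_erase, Finset.mem_powerset]
        exact ⟨Finset.nonempty_iff_ne_empty.1 ⟨v, Finset.mem_filter.2 ⟨hv, hvs⟩⟩,
          Finset.filter_subset _ _⟩
      refine le_trans ?_ (Finset.single_le_sum hnn hS)
      have h1 := isingEnergy_flipOn_ge hlam hM hadj hclosed (Finset.filter_subset _ _) hs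
        (x := x) (fun a ha b hb hbS => by
          rw [(Finset.mem_filter.1 ha).2]
          exact fun h => hbS (Finset.mem_filter.2 ⟨hb, h.symm⟩))
      rw [isingProb, isingProb, mul_div_assoc']
      refine div_le_div_of_nonneg_right ?_ (isingZ_pos G lam).le
      rw [hε, ← Real.exp_nat_mul, ← Real.exp_add]
      refine Real.exp_le_exp.2 ?_
      linarith
    have hex : ∀ s : ℤˣ, ∃ v ∈ W, x v = s := by
      intro s
      by_cases h : x i = s
      · exact ⟨i, hi, h⟩
      · refine ⟨j, hj, ?_⟩
        rcases Int.units_eq_one_or (x i) with h1 | h1 <;>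
          rcases Int.units_eq_one_or (x j) with h2 | h2 <;>
          rcases Int.units_eq_one_or s with h3 | h3 <;> simp_all
    have hsplit : (W.filter (x · = 1)).card + (W.filter (x · = -1)).card = W.card := by
      rw [← Finset.card_filter_add_card_filter_not (s := W) (x · = 1)]
      congr 2
      refine Finset.filter_congr fun v _ => ?_
      rcases Int.units_eq_one_or (x v) with h | h <;> simp [h]
    rcases le_total (W.filter (x · = 1)).card (W.filter (x · = -1)).card with h | h
    · exact hmain 1 (by omega) (hex 1)
    · exact hmain (-1) (by omega) (hex (-1))
  refine (Finset.sum_le_sum fun x _ => hpt x).trans ?_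
  rw [Finset.sum_comm]
  have h1 : ∀ S : Finset (Fin p), ∑ x, ε ^ S.card * isingProb G lam (flipOn S x) = ε ^ S.card := by
    intro S
    rw [← Finset.mul_sum, (flipOn_involutive S).bijective.sum_comp (fun x => isingProb G lam x),
      sum_isingProb, mul_one]
  simp only [h1]
  have h2 := Finset.sum_pow_mul_eq_add_pow ε 1 W
  rw [← Finset.add_sum_erase _ _ (Finset.empty_mem_powerset W)] at h2
  simp only [one_pow, mul_one, Finset.card_empty, pow_zero] at h2
  rw [add_comm 1 ε, ← h2]
  linarith

theorem disagreeProb_le_one {p : ℕ} (G : SimpleGraph (Fin p)) (lam : ℝ) (i j : Fin p) :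
    disagreeProb G lam i j ≤ 1 := by
  rw [← sum_isingProb G lam]
  refine Finset.sum_le_sum fun x _ => ?_
  split_ifs
  exacts [le_rfl, (isingProb_pos G lam x).le]

/-- The bound `disagreeProb_le` in linear form; where it exceeds `1` it holds trivially. -/
theorem disagreeProb_le_two_mul {p : ℕ} {G : SimpleGraph (Fin p)} {lam : ℝ} (hlam : 0 ≤ lam)
    {W M : Finset (Fin p)} (hM : M ⊆ W)
    (hadj : ∀ i ∈ M, ∀ j ∈ W, i ≠ j → G.Adj i j) (hclosed : ∀ i ∈ W, ∀ j, G.Adj i j → j ∈ W)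
    {i j : Fin p} (hi : i ∈ W) (hj : j ∈ W) :
    disagreeProb G lam i j ≤ 2 * (W.card * Real.exp (-(lam * M.card))) := by
  have h1 := disagreeProb_le hlam hM hadj hclosed hi hj
  have h2 := disagreeProb_le_one G lam i j
  set ε := Real.exp (-(lam * M.card))
  have hε0 : 0 < ε := Real.exp_pos _
  rcases le_or_gt ((W.card : ℝ) * ε) 1 with h | h
  · have h3 : (1 + ε) ^ W.card ≤ Real.exp (W.card * ε) := by
      rw [Real.exp_nat_mul]
      exact pow_le_pow_left₀ (by positivity) (by linarith [Real.add_one_le_exp ε]) _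
    have h4 := (abs_le.1 (Real.abs_exp_sub_one_le
      (show |(W.card : ℝ) * ε| ≤ 1 by rwa [abs_of_nonneg (by positivity)]))).2
    rw [abs_of_nonneg (by positivity)] at h4
    linarith
  · linarith

/-! ### Matchings -/

/-- The divergence of a single edge from no edge, `x tanh x - log cosh x`, is at most
`x tanh x / 2`. -/
theorem mul_tanh_div_two_le_log_cosh {x : ℝ} (hx : 0 ≤ x) :
    x * Real.tanh x / 2 ≤ Real.log (Real.cosh x) := by
  have hderiv : ∀ y : ℝ, HasDerivAt
      (fun y => Real.log (Real.cosh y) - y * (Real.sinh y / Real.cosh y) / 2)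
      ((Real.sinh y * Real.cosh y - y) / (2 * Real.cosh y ^ 2)) y := by
    intro y
    have hc := (Real.cosh_pos y).ne'
    have h := ((Real.hasDerivAt_cosh y).log hc).sub (((hasDerivAt_id y).mul
      ((Real.hasDerivAt_sinh y).div (Real.hasDerivAt_cosh y) hc)).div_const 2)
    refine h.congr_deriv ?_
    have hsq := Real.cosh_sq y
    simp only [id, Pi.div_apply]
    field_simp
    rw [hsq]
    ring
  have hmono : MonotoneOn
      (fun y => Real.log (Real.cosh y) - y * (Real.sinh y / Real.cosh y) / 2) (Set.Ici 0) := by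
    refine monotoneOn_of_deriv_nonneg (convex_Ici 0)
      (fun y _ => (hderiv y).continuousAt.continuousWithinAt)
      (fun y _ => (hderiv y).differentiableAt.differentiableWithinAt) fun y hy => ?_
    rw [interior_Ici] at hy
    have hy0 : (0 : ℝ) < y := hy
    rw [(hderiv y).deriv]
    refine div_nonneg ?_ (by positivity)
    nlinarith [Real.self_le_sinh_iff.2 hy0.le, Real.one_le_cosh y]
  have h := hmono (Set.mem_Ici.2 le_rfl) (Set.mem_Ici.2 hx) hx
  simp only [Real.cosh_zero, Real.log_one, zero_mul, zero_div, sub_zero] at h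
  rw [Real.tanh_eq_sinh_div_cosh]
  linarith

theorem tanh_pos_of_pos {x : ℝ} (hx : 0 < x) : 0 < Real.tanh x := by
  rw [Real.tanh_eq_sinh_div_cosh]
  exact div_pos (Real.sinh_pos_iff.2 hx) (Real.cosh_pos x)

theorem tanh_le_self_of_nonneg {x : ℝ} (hx : 0 ≤ x) : Real.tanh x ≤ x := by
  have hderiv : ∀ y : ℝ, HasDerivAt (fun y => y * Real.cosh y - Real.sinh y)
      (y * Real.sinh y) y := by
    intro y
    refine (((hasDerivAt_id y).mul (Real.hasDerivAt_cosh y)).sub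
      (Real.hasDerivAt_sinh y)).congr_deriv ?_
    simp
  have hmono : MonotoneOn (fun y => y * Real.cosh y - Real.sinh y) (Set.Ici 0) := by
    refine monotoneOn_of_deriv_nonneg (convex_Ici 0)
      (fun y _ => (hderiv y).continuousAt.continuousWithinAt)
      (fun y _ => (hderiv y).differentiableAt.differentiableWithinAt) fun y hy => ?_
    rw [interior_Ici] at hy
    have hy0 : (0 : ℝ) < y := hy
    rw [(hderiv y).deriv]
    exact mul_nonneg hy0.le (Real.sinh_nonneg_iff.2 hy0.le)
  have h := hmono (Set.mem_Ici.2 le_rfl) (Set.mem_Ici.2 hx) hx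
  simp only [Real.sinh_zero, zero_mul, sub_zero] at h
  rw [Real.tanh_eq_sinh_div_cosh, div_le_iff₀ (Real.cosh_pos x)]
  linarith

/-- The edge joining the `i`-th left vertex to the `j`-th right vertex. -/
def crossEdge {k m : ℕ} (i : Fin k) (j : Fin m) : Sym2 (Fin (k + m)) :=
  s(Fin.castAdd m i, Fin.natAdd k j)

theorem castAdd_ne_natAdd {k m : ℕ} (i : Fin k) (j : Fin m) :
    Fin.castAdd m i ≠ Fin.natAdd k j := by
  intro h
  have := congrArg Fin.val h
  simp only [Fin.val_castAdd, Fin.val_natAdd] at this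
  omega

theorem crossEdge_inj {k m : ℕ} {i i' : Fin k} {j j' : Fin m} :
    crossEdge i j = crossEdge i' j' ↔ i = i' ∧ j = j' := by
  rw [crossEdge, crossEdge, Sym2.eq_iff]
  simp [castAdd_ne_natAdd]

/-- The graph that joins the `i`-th left vertex to the `f i`-th right vertex, for all `i`;
a matching if `f` is injective. -/
def matchingGraph {k m : ℕ} (f : Fin k → Fin m) : SimpleGraph (Fin (k + m)) :=
  SimpleGraph.fromEdgeSet (Set.range fun i => crossEdge i (f i))

theorem edgeSet_matchingGraph {k m : ℕ} (f : Fin k → Fin m) :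
    (matchingGraph f).edgeSet = Set.range fun i => crossEdge i (f i) := by
  rw [matchingGraph, SimpleGraph.edgeSet_fromEdgeSet]
  refine sdiff_eq_left.2 (Set.disjoint_left.2 ?_)
  rintro _ ⟨i, rfl⟩ h
  simp [crossEdge, castAdd_ne_natAdd] at h

theorem crossEdge_apply_injective {k m : ℕ} (f : Fin k → Fin m) :
    Function.Injective fun i => crossEdge i (f i) := fun _ _ h => (crossEdge_inj.1 h).1

theorem isingEnergy_matchingGraph {k m : ℕ} (f : Fin k → Fin m) (lam : ℝ)
    (x : Fin (k + m) → ℤˣ) :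
    isingEnergy (matchingGraph f) lam x = lam * ∑ i, spinProd x (crossEdge i (f i)) := by
  classical
  have h : edges (matchingGraph f) = Finset.univ.image fun i => crossEdge i (f i) := by
    ext e
    simp [edgeSet_matchingGraph]
  rw [isingEnergy_eq_sum_edges, h,
    Finset.sum_image fun _ _ _ _ h => crossEdge_apply_injective f h]

theorem matchingGraph_mem_graphClass {k m d : ℕ} (hd : 1 ≤ d) {f : Fin k → Fin m}
    (hf : Function.Injective f) : matchingGraph f ∈ graphClass (k + m) k d := by
  constructor
  · rw [edgeSet_matchingGraph, ← Set.image_univ]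
    refine (Set.ncard_image_le).trans ?_
    simp [Set.ncard_univ]
  · intro v
    refine le_trans ?_ hd
    rw [Set.ncard_le_one]
    intro a ha b hb
    have hadj : ∀ c, c ∈ (matchingGraph f).neighborSet v → ∃ i, crossEdge i (f i) = s(v, c) := by
      intro c hc
      have : s(v, c) ∈ (matchingGraph f).edgeSet := hc
      rwa [edgeSet_matchingGraph] at this
    obtain ⟨i, hi⟩ := hadj a ha
    obtain ⟨i', hi'⟩ := hadj b hb
    rw [crossEdge, Sym2.eq_iff] at hi hi'
    rcases hi with ⟨h1, h2⟩ | ⟨h1, h2⟩ <;> rcases hi' with ⟨h3, h4⟩ | ⟨h3, h4⟩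
    · obtain rfl := Fin.castAdd_injective _ _ (h1.trans h3.symm)
      exact h2.symm.trans h4
    · exact absurd (h1.trans h4.symm) (castAdd_ne_natAdd _ _)
    · exact absurd (h3.trans h2.symm) (castAdd_ne_natAdd _ _)
    · obtain rfl := hf (Fin.natAdd_injective _ _ (h2.trans h4.symm))
      exact h1.symm.trans h3

/-- Given the right spins, the left ones are independent, and the sum over each of them is
`2 cosh λ` whatever the right spins are. -/
theorem isingZ_matchingGraph {k m : ℕ} (f : Fin k → Fin m) (lam : ℝ) :
    isingZ (matchingGraph f) lam = 2 ^ m * (2 * Real.cosh lam) ^ k := by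
  have h1 : ∀ s : ℤˣ, ∑ t : ℤˣ, Real.exp (lam * (((t * s : ℤˣ) : ℤ) : ℝ)) =
      2 * Real.cosh lam := by
    intro s
    have h2 : (Finset.univ : Finset ℤˣ) = {1, -1} := rfl
    rw [h2, Finset.sum_pair (by decide), Real.cosh_eq]
    rcases Int.units_eq_one_or s with rfl | rfl <;> simp <;> ring
  rw [isingZ, ← (Fin.appendEquiv k m).sum_comp, Fintype.sum_prod_type_right]
  simp only [isingEnergy_matchingGraph, crossEdge, spinProd_mk, Finset.mul_sum, Real.exp_sum,
    Fin.appendEquiv, Equiv.coe_fn_mk, Fin.append_left, Fin.append_right]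
  have h3 : ∀ y : Fin m → ℤˣ, ∑ x : Fin k → ℤˣ,
      ∏ i, Real.exp (lam * (((x i * y (f i) : ℤˣ) : ℤ) : ℝ)) = (2 * Real.cosh lam) ^ k := by
    intro y
    rw [← Fintype.prod_sum (fun i t => Real.exp (lam * (((t * y (f i) : ℤˣ) : ℤ) : ℝ))),
      Finset.prod_congr rfl fun i _ => h1 (y (f i))]
    simp
  simp only [h3]
  simp

/-- The mean energy is `λ` times the logarithmic derivative of the partition function. -/
theorem sum_isingProb_mul_isingEnergy_matchingGraph {k m : ℕ} (f : Fin k → Fin m) (lam : ℝ) :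
    ∑ x, isingProb (matchingGraph f) lam x * isingEnergy (matchingGraph f) lam x =
      k * (lam * Real.tanh lam) := by
  set E : (Fin (k + m) → ℤˣ) → ℝ := fun x => ∑ i, spinProd x (crossEdge i (f i))
  have hE : ∀ μ x, isingEnergy (matchingGraph f) μ x = μ * E x :=
    fun μ x => isingEnergy_matchingGraph f μ x
  have h1 : HasDerivAt (fun μ => isingZ (matchingGraph f) μ)
      (∑ x, Real.exp (lam * E x) * E x) lam := by
    simp only [isingZ, hE]
    refine HasDerivAt.fun_sum fun x _ => ?_
    have h := ((hasDerivAt_id lam).mul_const (E x)).exp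
    simpa using h
  have h2 : HasDerivAt (fun μ => isingZ (matchingGraph f) μ)
      (2 ^ m * (k * (2 * Real.cosh lam) ^ (k - 1) * (2 * Real.sinh lam))) lam := by
    simp only [isingZ_matchingGraph]
    exact (((Real.hasDerivAt_cosh lam).const_mul 2).pow k).const_mul _
  have h3 := h1.unique h2
  have hc := Real.cosh_pos lam
  simp only [isingProb, hE, isingZ_matchingGraph]
  have h4 : ∀ x, Real.exp (lam * E x) / (2 ^ m * (2 * Real.cosh lam) ^ k) * (lam * E x) =
      lam / (2 ^ m * (2 * Real.cosh lam) ^ k) * (Real.exp (lam * E x) * E x) := by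
    intro x
    ring
  rw [Finset.sum_congr rfl fun x _ => h4 x, ← Finset.mul_sum, h3, Real.tanh_eq_sinh_div_cosh]
  rcases k with _ | k
  · simp
  · rw [Nat.add_sub_cancel, pow_succ (2 * Real.cosh lam) k]
    field_simp

theorem isingKL_matchingGraph_bot_le {k m : ℕ} (f : Fin k → Fin m) {lam : ℝ} (hlam : 0 ≤ lam) :
    isingKL (matchingGraph f) ⊥ lam ≤ k * (lam * Real.tanh lam / 2) := by
  have h0 : ∀ x, isingEnergy (⊥ : SimpleGraph (Fin (k + m))) lam x = 0 := by
    intro x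
    simp [isingEnergy]
  have hZ : isingZ (⊥ : SimpleGraph (Fin (k + m))) lam = 2 ^ (k + m) := by
    simp [isingZ, h0]
  have hc := Real.cosh_pos lam
  rw [isingKL_eq, hZ, isingZ_matchingGraph]
  simp only [h0, sub_zero]
  rw [sum_isingProb_mul_isingEnergy_matchingGraph, Real.log_mul (by positivity) (by positivity),
    Real.log_pow, Real.log_pow, Real.log_pow, Real.log_mul (by norm_num) hc.ne']
  have h1 := mul_le_mul_of_nonneg_left (mul_tanh_div_two_le_log_cosh hlam)
    (Nat.cast_nonneg (α := ℝ) k)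
  push_cast
  linarith

theorem editDist_comm {p : ℕ} (G H : SimpleGraph (Fin p)) : editDist G H = editDist H G := by
  rw [editDist, editDist, symmDiff_comm]

theorem editDist_triangle {p : ℕ} (G H K : SimpleGraph (Fin p)) :
    editDist G K ≤ editDist G H + editDist H K := by
  classical
  simp only [editDist_eq_card]
  exact (Finset.card_le_card (symmDiff_triangle _ _ _)).trans (Finset.card_union_le _ _)

/-- Every changed position deletes one edge and creates another. -/
theorem two_mul_card_ne_le_editDist {k m : ℕ} (f g : Fin k → Fin m) :
    2 * (Finset.univ.filter fun i => f i ≠ g i).card ≤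
      editDist (matchingGraph f) (matchingGraph g) := by
  classical
  have h : ∀ f g : Fin k → Fin m, (Finset.univ.filter fun i => f i ≠ g i).card ≤
      (edges (matchingGraph f) \ edges (matchingGraph g)).card := by
    intro f g
    refine Finset.card_le_card_of_injOn (fun i => crossEdge i (f i)) ?_
      (crossEdge_apply_injective f).injOn
    intro i hi
    have hi' : f i ≠ g i := by simpa using hi
    simp only [Finset.coe_sdiff, Set.mem_sdiff, Finset.mem_coe, mem_edges, edgeSet_matchingGraph]
    refine ⟨⟨i, rfl⟩, ?_⟩
    rintro ⟨i', h⟩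
    obtain ⟨rfl, h⟩ := crossEdge_inj.1 h
    exact hi' h.symm
  have h1 := h f g
  have h2 := h g f
  simp only [ne_comm (a := g _)] at h2
  rw [editDist_eq_card, symmDiff_def, Finset.sup_eq_union,
    Finset.card_union_of_disjoint disjoint_sdiff_sdiff]
  omega

/-- Few matchings lie within edit distance `q` of any given graph: relative to one of them, each
of the others is determined by its at most `q` changed positions. -/
theorem card_matchingGraph_ball_le {k m q : ℕ} (hm : 1 ≤ m) (H : SimpleGraph (Fin (k + m))) :
    (Finset.univ.filter fun f : Fin k ↪ Fin m => editDist (matchingGraph f) H ≤ q).card ≤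
      2 ^ k * m ^ q := by
  classical
  rcases (Finset.univ.filter fun f : Fin k ↪ Fin m =>
    editDist (matchingGraph f) H ≤ q).eq_empty_or_nonempty with h0 | ⟨g, hg⟩
  · simp [h0]
  have hg' : editDist (matchingGraph g) H ≤ q := by simpa using hg
  set I : Finset (Finset (Fin k)) := Finset.univ.filter fun D => D.card ≤ q
  have hsub : (Finset.univ.filter fun f : Fin k ↪ Fin m => editDist (matchingGraph f) H ≤ q) ⊆
      I.biUnion fun D => Finset.univ.filter fun f : Fin k ↪ Fin m => ∀ i, i ∉ D → f i = g i := by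
    intro f hf
    have hf' : editDist (matchingGraph f) H ≤ q := by simpa using hf
    refine Finset.mem_biUnion.2 ⟨Finset.univ.filter fun i => f i ≠ g i, ?_, ?_⟩
    · have h1 := two_mul_card_ne_le_editDist f g
      have h2 := editDist_triangle (matchingGraph f) H (matchingGraph g)
      rw [editDist_comm H] at h2
      simp only [I, Finset.mem_filter, Finset.mem_univ, true_and]
      omega
    · simp
  have hD : ∀ D ∈ I,
      (Finset.univ.filter fun f : Fin k ↪ Fin m => ∀ i, i ∉ D → f i = g i).card ≤ m ^ q := by
    intro D hD
    have hDq : D.card ≤ q := by simpa [I] using hD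
    refine le_trans ?_ (Nat.pow_le_pow_right hm hDq)
    have h1 : (Finset.univ : Finset (D → Fin m)).card = m ^ D.card := by simp
    rw [← h1]
    refine Finset.card_le_card_of_injOn (fun f i => f i)
      (fun _ _ => Finset.mem_coe.2 (Finset.mem_univ _)) ?_
    intro f hf f' hf' heq
    ext i
    by_cases hi : i ∈ D
    · exact congrArg Fin.val (congrFun heq ⟨i, hi⟩)
    · have h2 : f i = g i := by simpa using (Finset.mem_filter.1 hf).2 i hi
      have h3 : f' i = g i := by simpa using (Finset.mem_filter.1 hf').2 i hi
      rw [h2, h3]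
  refine (Finset.card_le_card hsub).trans (Finset.card_biUnion_le.trans ?_)
  refine (Finset.sum_le_card_nsmul I _ _ hD).trans ?_
  rw [smul_eq_mul]
  refine Nat.mul_le_mul_right _ ((Finset.card_le_univ I).trans ?_)
  simp

/-- The bound from the ensemble of all matchings of `k` left vertices into the others. -/
theorem sample_bound_of_matchings {p k d n : ℕ} {lam δ θ : ℝ} {dec : Decoder n p} (hd : 1 ≤ d)
    (hk : 1 ≤ k) (hkp : 4 * k ≤ p) (hlam : 0 ≤ lam) (hθ : 0 ≤ θ)
    (hp : 2 * Real.log 2 ≤ (1 - θ) * Real.log p)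
    (hδ : worstErrProb k d lam ⌊θ * (k : ℝ)⌋₊ dec ≤ δ) :
    (1 - δ) * ((1 - θ) * Real.log p) - 3 * Real.log 2 ≤ n * (lam * Real.tanh lam / 2) := by
  classical
  have hδ0 : 0 ≤ δ := (worstErrProb_nonneg _ _ _).trans hδ
  obtain ⟨m, rfl⟩ : ∃ m, p = k + m := ⟨p - k, by omega⟩
  have hp0 : (0 : ℝ) < ((k + m : ℕ) : ℝ) := by exact_mod_cast (by omega : 0 < k + m)
  have hp1 : 0 ≤ Real.log ((k + m : ℕ) : ℝ) := Real.log_natCast_nonneg _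
  have hk1 : (1 : ℝ) ≤ k := by exact_mod_cast hk
  set ℓ := Real.log ((k + m : ℕ) : ℝ)
  have hq : ((⌊θ * (k : ℝ)⌋₊ : ℕ) : ℝ) ≤ θ * k := Nat.floor_le (by positivity)
  set q := ⌊θ * (k : ℝ)⌋₊
  have hcount : (2 : ℝ) ^ k * (m : ℝ) ^ q * Real.exp (k * ((1 - θ) * ℓ - 2 * Real.log 2)) ≤
      (m.descFactorial k : ℝ) := by
    have h1 : (m : ℝ) ^ q ≤ Real.exp (θ * k * ℓ) := by
      calc (m : ℝ) ^ q ≤ ((k + m : ℕ) : ℝ) ^ q := by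
            refine pow_le_pow_left₀ (by positivity) ?_ _
            exact_mod_cast Nat.le_add_left m k
        _ = Real.exp (q * ℓ) := by rw [Real.exp_nat_mul, Real.exp_log hp0]
        _ ≤ _ := Real.exp_le_exp.2 (mul_le_mul_of_nonneg_right hq hp1)
    have h2 : (2 : ℝ) ^ k = Real.exp (k * Real.log 2) := by
      rw [Real.exp_nat_mul, Real.exp_log (by norm_num)]
    calc (2 : ℝ) ^ k * (m : ℝ) ^ q * Real.exp (k * ((1 - θ) * ℓ - 2 * Real.log 2))
        ≤ Real.exp (k * Real.log 2) * Real.exp (θ * k * ℓ) *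
            Real.exp (k * ((1 - θ) * ℓ - 2 * Real.log 2)) := by
          rw [← h2]
          gcongr
      _ = Real.exp (k * (ℓ - Real.log 2)) := by
          rw [← Real.exp_add, ← Real.exp_add]
          congr 1
          ring
      _ = (((k + m : ℕ) : ℝ) / 2) ^ k := by
          rw [Real.exp_nat_mul, Real.exp_sub, Real.exp_log hp0, Real.exp_log (by norm_num)]
      _ ≤ ((m + 1 - k : ℕ) : ℝ) ^ k := by
          refine pow_le_pow_left₀ (by positivity) ?_ _
          rw [div_le_iff₀ (by norm_num)]
          exact_mod_cast (by omega : k + m ≤ (m + 1 - k) * 2)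
      _ ≤ (m.descFactorial k : ℝ) := by exact_mod_cast Nat.pow_sub_le_descFactorial m k
  have hcardT : (Finset.univ : Finset (Fin k ↪ Fin m)).card = m.descFactorial k := by
    rw [Finset.card_univ, Fintype.card_embedding_eq]
    simp
  have hkm : k ≤ m := by omega
  have hfano := fano_ising hδ (Finset.univ : Finset (Fin k ↪ Fin m))
    ⟨Fin.castLEEmb hkm, Finset.mem_univ _⟩ (fun f => matchingGraph f) ⊥
    (fun f _ => matchingGraph_mem_graphClass hd f.injective)
    (fun f _ => isingKL_matchingGraph_bot_le f hlam)
    (L := k * ((1 - θ) * ℓ - 2 * Real.log 2)) (mul_nonneg (by positivity) (by linarith)) (by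
      intro H
      rw [hcardT]
      refine le_trans (mul_le_mul_of_nonneg_right ?_ (Real.exp_pos _).le) hcount
      exact_mod_cast card_matchingGraph_ball_le (by omega) H)
  have hl2 : 0 < Real.log 2 := Real.log_pos (by norm_num)
  have h3 : (k : ℝ) * ((1 - δ) * ((1 - θ) * ℓ) - 3 * Real.log 2) ≤
      k * (n * (lam * Real.tanh lam / 2)) := by
    nlinarith [mul_nonneg hδ0 (mul_nonneg (by positivity : (0 : ℝ) ≤ k) hl2.le),
      mul_nonneg (sub_nonneg.2 hk1) hl2.le]
  exact le_of_mul_le_mul_left h3 (by positivity)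

/-! ### Hamming balls and binary entropy -/

/-- The volume of a Hamming ball of relative radius `t ≤ 1 / 2` is at most `e^{|A| H(t)}`. -/
theorem card_hamming_ball_le {α : Type*} [DecidableEq α] {A R : Finset α} (hR : R ⊆ A) {t : ℝ}
    (ht : 0 < t) (ht' : t ≤ 1 / 2) {q : ℕ} (hq : (q : ℝ) ≤ A.card * t) :
    ((A.powerset.filter fun S => (symmDiff S R).card ≤ q).card : ℝ) ≤
      Real.exp (A.card * Real.binEntropy t) := by
  have hmem : ∀ S ∈ A.powerset, symmDiff S R ∈ A.powerset := fun S hS =>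
    Finset.mem_powerset.2 (symmDiff_le (le_sup_of_le_right (Finset.mem_powerset.1 hS))
      (le_sup_of_le_right hR))
  -- Under the product Bernoulli measure of parameter `t` centred at `R`, each member of the ball
  -- has weight at least `exp (-|A| H(t))`.
  have hsum : ∑ S ∈ A.powerset, t ^ (symmDiff S R).card * (1 - t) ^ (A.card - (symmDiff S R).card)
      = 1 := by
    rw [Finset.sum_nbij' (s := A.powerset) (t := A.powerset) (symmDiff · R) (symmDiff · R)
      (g := fun S => t ^ S.card * (1 - t) ^ (A.card - S.card)) hmem hmem
      (fun S _ => by simp) (fun S _ => by simp) (fun S _ => rfl),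
      Finset.sum_pow_mul_eq_add_pow]
    simp
  have h1t : 0 < 1 - t := by linarith
  have hle : ∀ S ∈ A.powerset.filter fun S => (symmDiff S R).card ≤ q,
      Real.exp (-(A.card * Real.binEntropy t)) ≤
        t ^ (symmDiff S R).card * (1 - t) ^ (A.card - (symmDiff S R).card) := by
    intro S hS
    obtain ⟨hSA, hSq⟩ := Finset.mem_filter.1 hS
    have hjA := Finset.card_le_card (Finset.mem_powerset.1 (hmem S hSA))
    set j := (symmDiff S R).card
    have hj : (j : ℝ) ≤ A.card * t := le_trans (by exact_mod_cast hSq) hq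
    have h2 : t ^ j * (1 - t) ^ (A.card - j) =
        Real.exp (j * Real.log t + ((A.card : ℝ) - j) * Real.log (1 - t)) := by
      rw [Real.exp_add, Real.exp_nat_mul, Real.exp_log ht, ← Nat.cast_sub hjA, Real.exp_nat_mul,
        Real.exp_log h1t]
    rw [h2]
    refine Real.exp_le_exp.2 ?_
    have h3 : Real.log t ≤ Real.log (1 - t) := Real.log_le_log ht (by linarith)
    rw [Real.binEntropy, Real.log_inv, Real.log_inv]
    nlinarith [mul_nonneg (sub_nonneg.2 hj) (sub_nonneg.2 h3)]
  have h4 := Finset.card_nsmul_le_sum _ _ _ hle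
  have h5 : ∑ S ∈ A.powerset.filter (fun S => (symmDiff S R).card ≤ q),
      t ^ (symmDiff S R).card * (1 - t) ^ (A.card - (symmDiff S R).card) ≤ 1 := by
    exact (Finset.sum_le_sum_of_subset_of_nonneg (Finset.filter_subset _ _)
      fun S _ _ => by positivity).trans hsum.le
  have h6 := h4.trans h5
  rw [nsmul_eq_mul, Real.exp_neg, ← div_eq_mul_inv, div_le_one (Real.exp_pos _)] at h6
  exact h6

/-! ### Disjoint blocks -/

/-- The disjoint union of `B` cliques: inside each of the `B` blocks of `s` vertices labelled by
`e`, all pairs of vertices with positions in `I` are joined. -/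
def blockGraph {p B s : ℕ} (e : Fin B × Fin s ↪ Fin p) (I : Finset (Fin s)) :
    SimpleGraph (Fin p) where
  Adj u v := ∃ b, ∃ i ∈ I, ∃ j ∈ I, i ≠ j ∧ e (b, i) = u ∧ e (b, j) = v
  symm := ⟨fun _ _ ⟨b, i, hi, j, hj, hij, hu, hv⟩ => ⟨b, j, hj, i, hi, hij.symm, hv, hu⟩⟩
  loopless := ⟨fun u ⟨b, i, _, j, _, hij, hu, hv⟩ => hij (by
    have h := e.injective (hu.trans hv.symm)
    exact (Prod.mk.injEq .. ▸ h).2)⟩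

theorem card_edges_blockGraph {p B s : ℕ} (e : Fin B × Fin s ↪ Fin p) (I : Finset (Fin s)) :
    (edges (blockGraph e I)).card = B * I.card.choose 2 := by
  classical
  have hinj : Set.InjOn (fun bz : Fin B × Sym2 (Fin s) => bz.2.map fun i => e (bz.1, i))
      ((Finset.univ : Finset (Fin B)) ×ˢ I.offDiag.image Sym2.mk.uncurry : Finset _) := by
    rintro ⟨b, z⟩ _ ⟨b', z'⟩ _ h
    induction z using Sym2.ind with
    | _ i j =>
      induction z' using Sym2.ind with
      | _ i' j' =>
        simp only [Sym2.map_mk, Sym2.eq_iff, e.injective.eq_iff, Prod.mk.injEq] at h ⊢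
        tauto
  have h : edges (blockGraph e I) =
      ((Finset.univ : Finset (Fin B)) ×ˢ I.offDiag.image Sym2.mk.uncurry).image
        (fun bz : Fin B × Sym2 (Fin s) => bz.2.map fun i => e (bz.1, i)) := by
    ext z
    induction z using Sym2.ind with
    | _ u v =>
      simp only [mem_edges, SimpleGraph.mem_edgeSet, Finset.mem_image, Finset.mem_product,
        Finset.mem_univ, true_and, Finset.mem_offDiag, Prod.exists, blockGraph]
      constructor
      · rintro ⟨b, i, hi, j, hj, hij, rfl, rfl⟩
        exact ⟨b, s(i, j), ⟨i, j, ⟨hi, hj, hij⟩, rfl⟩, rfl⟩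
      · rintro ⟨b, _, ⟨i, j, ⟨hi, hj, hij⟩, rfl⟩, h⟩
        rcases Sym2.eq_iff.1 h with ⟨h1, h2⟩ | ⟨h1, h2⟩
        · exact ⟨b, i, hi, j, hj, hij, h1, h2⟩
        · exact ⟨b, j, hj, i, hi, hij.symm, h2, h1⟩
  rw [h, Finset.card_image_of_injOn hinj, Finset.card_product, Finset.card_univ, Fintype.card_fin]
  congr 1
  exact Sym2.card_image_offDiag I

theorem ncard_neighborSet_blockGraph_le {p B d : ℕ} (e : Fin B × Fin (d + 1) ↪ Fin p)
    (I : Finset (Fin (d + 1))) (v : Fin p) : ((blockGraph e I).neighborSet v).ncard ≤ d := by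
  classical
  rcases ((blockGraph e I).neighborSet v).eq_empty_or_nonempty with h | ⟨w, b, i, _, _, _, _, hv, _⟩
  · simp [h]
  · have hsub : (blockGraph e I).neighborSet v ⊆
        ((Finset.univ.erase i).image fun j => e (b, j) : Finset (Fin p)) := by
      rintro w ⟨b', i', _, j, _, hij, hv', rfl⟩
      have h := e.injective (hv.trans hv'.symm)
      simp only [Prod.mk.injEq] at h
      obtain ⟨rfl, rfl⟩ := h
      simp [hij.symm]
    refine (Set.ncard_le_ncard hsub).trans ?_
    rw [Set.ncard_coe_finset]
    refine Finset.card_image_le.trans ?_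
    simp

/-- The cliques on all of the blocks, without the edges between positions in `I`. Each block
keeps a hub, formed by its vertices with positions outside `I` and joined to the whole block. -/
def hubGraph {p B s : ℕ} (e : Fin B × Fin s ↪ Fin p) (I : Finset (Fin s)) :
    SimpleGraph (Fin p) :=
  blockGraph e Finset.univ \ blockGraph e I

theorem edges_subset_edges {p : ℕ} {G H : SimpleGraph (Fin p)} (h : G ≤ H) :
    edges G ⊆ edges H := fun e he => by
  rw [mem_edges] at he ⊢
  exact SimpleGraph.edgeSet_mono h he

theorem blockGraph_mono {p B s : ℕ} (e : Fin B × Fin s ↪ Fin p) {I J : Finset (Fin s)}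
    (h : I ⊆ J) : blockGraph e I ≤ blockGraph e J :=
  fun _ _ ⟨b, i, hi, j, hj, r⟩ => ⟨b, i, h hi, j, h hj, r⟩

open scoped Classical in
theorem edges_hubGraph {p B s : ℕ} (e : Fin B × Fin s ↪ Fin p) (I : Finset (Fin s)) :
    edges (hubGraph e I) = edges (blockGraph e Finset.univ) \ edges (blockGraph e I) := by
  ext z
  simp [hubGraph]

open scoped Classical in
theorem edges_sup_fromEdgeSet {p : ℕ} (G H : SimpleGraph (Fin p)) {S : Finset (Sym2 (Fin p))}
    (hS : S ⊆ edges H) :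
    edges (G ⊔ SimpleGraph.fromEdgeSet (S : Set (Sym2 (Fin p)))) = edges G ∪ S := by
  ext z
  simp only [mem_edges, SimpleGraph.edgeSet_sup, SimpleGraph.edgeSet_fromEdgeSet, Set.mem_union,
    Set.mem_sdiff, Finset.mem_coe, Finset.mem_union]
  refine or_congr Iff.rfl (and_iff_left_of_imp fun hz => ?_)
  exact H.not_isDiag_of_mem_edgeSet (mem_edges.1 (hS hz))

theorem disagreeProb_hubGraph_le {p B s : ℕ} (e : Fin B × Fin s ↪ Fin p) (I : Finset (Fin s))
    {lam : ℝ} (hlam : 0 ≤ lam) {u v : Fin p} (huv : s(u, v) ∈ edges (blockGraph e I)) :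
    disagreeProb (hubGraph e I) lam u v ≤
      2 * (s * Real.exp (-(lam * ((s - I.card : ℕ) : ℝ)))) := by
  classical
  obtain ⟨b, i, -, j, -, -, rfl, rfl⟩ : (blockGraph e I).Adj u v := by simpa using huv
  have hinj : Function.Injective fun i => e (b, i) := fun i j h => by
    simpa using e.injective h
  have h := disagreeProb_le_two_mul (G := hubGraph e I) hlam
    (W := Finset.univ.image fun i => e (b, i)) (M := Iᶜ.image fun i => e (b, i))
    (i := e (b, i)) (j := e (b, j))
    (Finset.image_subset_image (Finset.subset_univ _)) ?_ ?_ (by simp) (by simp)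
  · rwa [Finset.card_image_of_injective _ hinj, Finset.card_image_of_injective _ hinj,
      Finset.card_compl, Finset.card_univ, Fintype.card_fin] at h
  · intro u hu v hv huv
    obtain ⟨i, hi, rfl⟩ := Finset.mem_image.1 hu
    obtain ⟨j, -, rfl⟩ := Finset.mem_image.1 hv
    refine ⟨⟨b, i, Finset.mem_univ _, j, Finset.mem_univ _, fun h => huv (h ▸ rfl), rfl, rfl⟩, ?_⟩
    rintro ⟨b', i', hi', j', -, -, h, -⟩
    have h' := e.injective h
    simp only [Prod.mk.injEq] at h'
    exact (Finset.mem_compl.1 hi) (h'.2 ▸ hi')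
  · rintro u hu v ⟨⟨b', i', -, j', -, -, rfl, rfl⟩, -⟩
    obtain ⟨i, -, h⟩ := Finset.mem_image.1 hu
    have h' := e.injective h
    simp only [Prod.mk.injEq] at h'
    rw [← h'.1]
    exact Finset.mem_image.2 ⟨j', Finset.mem_univ _, rfl⟩

open scoped Classical in
theorem card_symmDiff_le_editDist {p : ℕ} {G G₀ : SimpleGraph (Fin p)}
    {A S : Finset (Sym2 (Fin p))} (hG : edges G = edges G₀ ∪ S) (hS : S ⊆ A)
    (hA : Disjoint (edges G₀) A) (H : SimpleGraph (Fin p)) :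
    (symmDiff S (edges H ∩ A)).card ≤ editDist G H := by
  rw [editDist_eq_card, hG]
  refine Finset.card_le_card fun z hz => ?_
  have h1 : z ∈ S → z ∈ A := fun h => hS h
  have h2 : z ∈ edges G₀ → z ∉ A := fun h => Finset.disjoint_left.1 hA h
  simp only [Finset.mem_symmDiff, Finset.mem_inter, Finset.mem_union] at hz ⊢
  tauto

/-- The bound from the ensemble of all graphs between the hubs and the full cliques. -/
theorem sample_bound_of_blocks {p k d n B q : ℕ} {lam δ t : ℝ} {dec : Decoder n p}
    (e : Fin B × Fin (d + 1) ↪ Fin p) (I : Finset (Fin (d + 1)))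
    (hk : B * (d + 1).choose 2 ≤ k) (hlam : 0 ≤ lam) (ht : 0 < t) (ht' : t ≤ 1 / 2)
    (hq : (q : ℝ) ≤ (B * I.card.choose 2 : ℕ) * t)
    (hδ : worstErrProb k d lam q dec ≤ δ) :
    (1 - δ) * ((B * I.card.choose 2 : ℕ) * (Real.log 2 - Real.binEntropy t)) ≤
      n * ((B * I.card.choose 2 : ℕ) * (2 * lam * (2 * ((d + 1 : ℕ) *
        Real.exp (-(lam * ((d + 1 - I.card : ℕ) : ℝ))))))) + Real.log 2 := by
  classical
  set A := edges (blockGraph e I) with hAdef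
  have hAcard : B * I.card.choose 2 = A.card := (card_edges_blockGraph e I).symm
  rw [hAcard] at hq ⊢
  have hdisj : Disjoint (edges (hubGraph e I)) A := by
    rw [edges_hubGraph]
    exact Finset.sdiff_disjoint
  let G : Finset (Sym2 (Fin p)) → SimpleGraph (Fin p) := fun S =>
    hubGraph e I ⊔ SimpleGraph.fromEdgeSet (S : Set (Sym2 (Fin p)))
  have hG : ∀ S ∈ A.powerset, edges (G S) = edges (hubGraph e I) ∪ S := fun S hS =>
    edges_sup_fromEdgeSet _ _ (Finset.mem_powerset.1 hS)
  have hGle : ∀ S ∈ A.powerset, G S ≤ blockGraph e Finset.univ := by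
    intro S hS
    refine sup_le sdiff_le ?_
    intro u v huv
    have h1 : s(u, v) ∈ A := Finset.mem_powerset.1 hS ((SimpleGraph.fromEdgeSet_adj _).1 huv).1
    exact blockGraph_mono e (Finset.subset_univ I) (by simpa [A] using h1)
  refine fano_ising hδ A.powerset ⟨∅, Finset.empty_mem_powerset A⟩ G (hubGraph e I) ?_ ?_ ?_ ?_
  · intro S hS
    refine ⟨?_, fun v => ?_⟩
    · rw [← card_edges]
      refine (Finset.card_le_card (edges_subset_edges (hGle S hS))).trans ?_
      rw [card_edges_blockGraph]
      simpa using hk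
    · exact (Set.ncard_le_ncard fun w hw => hGle S hS hw).trans
        (ncard_neighborSet_blockGraph_le e Finset.univ v)
  · intro S hS
    have hSA := Finset.mem_powerset.1 hS
    refine (isingKL_le_of_disagreeProb_le hlam S (hG S hS) (hdisj.mono_right hSA)
      fun i j hij => disagreeProb_hubGraph_le e I hlam (hSA hij)).trans ?_
    refine mul_le_mul_of_nonneg_right ?_ (by positivity)
    exact_mod_cast Finset.card_le_card hSA
  · exact mul_nonneg (Nat.cast_nonneg _) (sub_nonneg.2 Real.binEntropy_le_log_two)
  · intro H
    have h1 : ((A.powerset.filter fun S => editDist (G S) H ≤ q).card : ℝ) ≤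
        Real.exp (A.card * Real.binEntropy t) := by
      refine le_trans ?_ (card_hamming_ball_le (Finset.inter_subset_right (s₁ := edges H)) ht ht' hq)
      refine Nat.cast_le.2 (Finset.card_le_card fun S hS => ?_)
      obtain ⟨hS, hSq⟩ := Finset.mem_filter.1 hS
      exact Finset.mem_filter.2 ⟨hS, (card_symmDiff_le_editDist (hG S hS)
        (Finset.mem_powerset.1 hS) hdisj H).trans hSq⟩
    refine (mul_le_mul_of_nonneg_right h1 (Real.exp_pos _).le).trans (le_of_eq ?_)
    rw [← Real.exp_add, Finset.card_powerset, Nat.cast_pow, Nat.cast_ofNat,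
      ← Real.exp_log (show (0 : ℝ) < 2 by norm_num), ← Real.exp_nat_mul, Real.log_exp]
    congr 1
    ring

/-- The number of non-hub pairs, as a share of `k`. The hub has `⌊(d + 1) / 4⌋` of the `d + 1`
vertices of a block, large enough to correlate the block and small enough that more than a
fraction `(d - 2) / (2 d)` of the edges avoid it; the excess pays for rounding the number of
blocks. -/
theorem le_card_free_edges {k d : ℕ} (hd : 2 < d) (hk : 9 * d ^ 2 ≤ k) :
    (k : ℝ) * ((d : ℝ) - 2) ≤
      2 * d * ((k / (d + 1).choose 2 * (d + 1 - (d + 1) / 4).choose 2 : ℕ) : ℝ) := by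
  set m := (d + 1) / 4 with hm
  set B := k / (d + 1).choose 2 with hB
  have hm4 : 4 * m ≤ d + 1 := by omega
  have hdR : (2 : ℝ) < d := by exact_mod_cast hd
  have hkR : 9 * (d : ℝ) ^ 2 ≤ k := by exact_mod_cast hk
  have hmR : 4 * (m : ℝ) ≤ d + 1 := by exact_mod_cast hm4
  have hmd : m ≤ d + 1 := by omega
  have hcpos : 0 < (d + 1).choose 2 := Nat.choose_pos (by omega)
  have hc : (((d + 1).choose 2 : ℕ) : ℝ) = (d + 1) * d / 2 := by
    rw [Nat.cast_choose_two]
    push_cast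
    ring
  have hBk : (k : ℝ) ≤ ((d + 1) * d / 2) * (B + 1) := by
    rw [← hc]
    exact_mod_cast (Nat.lt_mul_div_succ k hcpos).le
  have hI : (((d + 1 - m).choose 2 : ℕ) : ℝ) = (d + 1 - m) * (d - m) / 2 := by
    rw [Nat.cast_choose_two, Nat.cast_sub hmd]
    push_cast
    ring
  have hI' : ((d : ℝ) + 1) * (9 * d - 3) ≤ 16 * ((d + 1 - m) * (d - m)) := by
    nlinarith
  push_cast
  rw [hI]
  have hB0 : (0 : ℝ) ≤ B := Nat.cast_nonneg B
  have h1 : (B : ℝ) * d * (((d : ℝ) + 1) * (9 * d - 3)) ≤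
      B * d * (16 * ((d + 1 - m) * (d - m))) := mul_le_mul_of_nonneg_left hI' (by positivity)
  have h2 : (2 * k - ((d : ℝ) + 1) * d) * (9 * d - 3) ≤ ((d + 1) * d * B) * (9 * d - 3) :=
    mul_le_mul_of_nonneg_right (by linarith) (by linarith)
  have h3 : 9 * (d : ℝ) ^ 2 * (2 * d + 26) ≤ k * (2 * d + 26) :=
    mul_le_mul_of_nonneg_right hkR (by linarith)
  have h4 : ((d : ℝ) + 1) * d * (9 * d - 3) ≤ 9 * (d : ℝ) ^ 2 * (2 * d + 26) := by
    nlinarith [sq_nonneg (d : ℝ)]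
  nlinarith

/-- The exponential bound, with its additive loss explicit. -/
theorem sample_bound_exp {p k d n : ℕ} {lam δ θ : ℝ} {dec : Decoder n p} (hd : 2 < d)
    (hk : 9 * d ^ 2 ≤ k) (hkp : 4 * k ≤ p) (hlam : 0 ≤ lam) (hθ : 0 < θ)
    (hθd : θ < 1 / 4 * (((d : ℝ) - 2) / (d : ℝ)))
    (hδ : worstErrProb k d lam ⌊θ * (k : ℝ)⌋₊ dec ≤ δ) :
    (1 - δ) * (Real.log 2 - Real.binEntropy ((d : ℝ) / ((d : ℝ) - 2) * (2 * θ))) -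
        6 * Real.log 2 / k ≤
      n * (3 * lam * (d : ℝ) ^ 2 * Real.exp (-(lam * ((d : ℝ) - 2) / 4))) := by
  have hdR : (3 : ℝ) ≤ d := by exact_mod_cast hd
  have hd2 : (0 : ℝ) < (d : ℝ) - 2 := by linarith
  have hk0 : (0 : ℝ) < k := by
    have : 0 < 9 * d ^ 2 := by positivity
    exact_mod_cast this.trans_le hk
  set t := (d : ℝ) / ((d : ℝ) - 2) * (2 * θ) with ht
  have ht0 : 0 < t := by positivity
  have ht1 : t ≤ 1 / 2 := by
    rw [← mul_div_assoc, lt_div_iff₀ (by linarith)] at hθd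
    rw [ht, div_mul_eq_mul_div, div_le_iff₀ hd2]
    linarith
  obtain ⟨I, hI⟩ : ∃ I : Finset (Fin (d + 1)), I.card = d + 1 - (d + 1) / 4 := by
    obtain ⟨I, -, hI⟩ := Finset.exists_subset_card_eq
      (s := (Finset.univ : Finset (Fin (d + 1)))) (n := d + 1 - (d + 1) / 4) (by simp)
    exact ⟨I, hI⟩
  set B := k / (d + 1).choose 2 with hB
  have hBk : B * (d + 1).choose 2 ≤ k := Nat.div_mul_le_self _ _
  have hBp : B * (d + 1) ≤ p := by
    have h1 : d + 1 ≤ (d + 1).choose 2 := by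
      rw [Nat.choose_two_right, Nat.le_div_iff_mul_le (by norm_num), Nat.add_sub_cancel]
      exact Nat.mul_le_mul_left _ (by omega)
    have h2 := Nat.mul_le_mul_left B h1
    omega
  let e : Fin B × Fin (d + 1) ↪ Fin p :=
    finProdFinEquiv.toEmbedding.trans (Fin.castLEEmb hBp)
  have hN := le_card_free_edges hd hk
  rw [← hI, ← hB] at hN
  set N : ℝ := ((B * I.card.choose 2 : ℕ) : ℝ) with hNdef
  have hNk : k / 6 ≤ N := by
    have h1 : (k : ℝ) * d ≤ 6 * d * N := by
      nlinarith [mul_nonneg hk0.le (show (0 : ℝ) ≤ d - 3 by linarith)]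
    have h2 : (d : ℝ) * (k / 6) ≤ d * N := by linarith
    exact le_of_mul_le_mul_left h2 (by linarith)
  have hN0 : 0 < N := by linarith [div_pos hk0 (show (0 : ℝ) < 6 by norm_num)]
  have hq : ((⌊θ * (k : ℝ)⌋₊ : ℕ) : ℝ) ≤ N * t := by
    refine (Nat.floor_le (by positivity)).trans ?_
    rw [ht, div_mul_eq_mul_div, mul_div_assoc', le_div_iff₀ hd2]
    nlinarith [mul_le_mul_of_nonneg_left hN hθ.le]
  have hmain := sample_bound_of_blocks e I hBk hlam ht0 ht1 hq hδ
  rw [← hNdef] at hmain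
  set h := Real.log 2 - Real.binEntropy t
  have hm : ((d : ℝ) - 2) / 4 ≤ ((d + 1 - I.card : ℕ) : ℝ) := by
    rw [div_le_iff₀ (by norm_num), sub_le_iff_le_add]
    have : d ≤ (d + 1 - I.card) * 4 + 2 := by omega
    exact_mod_cast this
  have hexp : Real.exp (-(lam * ((d + 1 - I.card : ℕ) : ℝ))) ≤
      Real.exp (-(lam * ((d : ℝ) - 2) / 4)) := by
    refine Real.exp_le_exp.2 ?_
    have := mul_le_mul_of_nonneg_left hm hlam
    linarith
  have hD : 2 * lam * (2 * ((d + 1 : ℕ) * Real.exp (-(lam * ((d + 1 - I.card : ℕ) : ℝ))))) ≤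
      3 * lam * (d : ℝ) ^ 2 * Real.exp (-(lam * ((d : ℝ) - 2) / 4)) := by
    have h1 : 4 * ((d : ℝ) + 1) ≤ 3 * (d : ℝ) ^ 2 := by nlinarith
    calc 2 * lam * (2 * ((d + 1 : ℕ) * Real.exp (-(lam * ((d + 1 - I.card : ℕ) : ℝ)))))
        = lam * (4 * ((d : ℝ) + 1)) * Real.exp (-(lam * ((d + 1 - I.card : ℕ) : ℝ))) := by
          push_cast
          ring
      _ ≤ lam * (3 * (d : ℝ) ^ 2) * Real.exp (-(lam * ((d : ℝ) - 2) / 4)) := by gcongr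
      _ = _ := by ring
  have hnD := mul_le_mul_of_nonneg_left hD (Nat.cast_nonneg (α := ℝ) n)
  have hl2 : 0 < Real.log 2 := Real.log_pos (by norm_num)
  have hrem : Real.log 2 ≤ N * (6 * Real.log 2 / k) := by
    rw [mul_div_assoc', le_div_iff₀ hk0]
    nlinarith
  refine le_of_mul_le_mul_left ?_ hN0
  nlinarith [mul_le_mul_of_nonneg_left hnD hN0.le]

/-! ### Uniformity in the degree and the remainder term -/

/-- The entropy deficit is bounded below uniformly over the admissible degrees: its argument
decreases in `d`, so that the least admissible degree is the worst one. -/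
theorem exists_entropy_gap {θ : ℝ} (hθ : 0 < θ) :
    ∃ c : ℝ, 0 < c ∧ ∀ d : ℕ, 2 < d → θ < 1 / 4 * (((d : ℝ) - 2) / (d : ℝ)) →
      c ≤ Real.log 2 - Real.binEntropy ((d : ℝ) / ((d : ℝ) - 2) * (2 * θ)) := by
  classical
  have harg : ∀ d : ℕ, 2 < d → θ < 1 / 4 * (((d : ℝ) - 2) / (d : ℝ)) →
      0 < (d : ℝ) / ((d : ℝ) - 2) * (2 * θ) ∧ (d : ℝ) / ((d : ℝ) - 2) * (2 * θ) < 2⁻¹ := by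
    intro d hd hθd
    have hdR : (2 : ℝ) < d := by exact_mod_cast hd
    have hd2 : (0 : ℝ) < (d : ℝ) - 2 := by linarith
    refine ⟨by positivity, ?_⟩
    rw [← mul_div_assoc, lt_div_iff₀ (by linarith)] at hθd
    rw [div_mul_eq_mul_div, div_lt_iff₀ hd2]
    linarith
  by_cases hex : ∃ d : ℕ, 2 < d ∧ θ < 1 / 4 * (((d : ℝ) - 2) / (d : ℝ))
  · obtain ⟨h0, hθ0⟩ := Nat.find_spec hex
    have hmin : ∀ d : ℕ, 2 < d → θ < 1 / 4 * (((d : ℝ) - 2) / (d : ℝ)) → Nat.find hex ≤ d :=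
      fun d hd hθd => Nat.find_min' hex ⟨hd, hθd⟩
    set d₀ := Nat.find hex
    obtain ⟨ht0, ht1⟩ := harg d₀ h0 hθ0
    refine ⟨Real.log 2 - Real.binEntropy ((d₀ : ℝ) / ((d₀ : ℝ) - 2) * (2 * θ)),
      sub_pos.2 (Real.binEntropy_lt_log_two.2 ht1.ne), fun d hd hθd => ?_⟩
    obtain ⟨ht2, ht3⟩ := harg d hd hθd
    refine sub_le_sub_left (Real.binEntropy_strictMonoOn.monotoneOn ⟨ht2.le, ht3.le⟩
      ⟨ht0.le, ht1.le⟩ ?_) _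
    have h1 : (2 : ℝ) < d₀ := by exact_mod_cast h0
    have h2 : (d₀ : ℝ) ≤ d := by exact_mod_cast hmin d hd hθd
    refine mul_le_mul_of_nonneg_right ?_ (by positivity)
    rw [div_le_div_iff₀ (by linarith) (by linarith)]
    linarith
  · exact ⟨1, one_pos, fun d hd hθd => absurd ⟨d, hd, hθd⟩ hex⟩

/-- The remainder term: `1`, which makes the bounds void, for small `t`, and otherwise the sum of
the relative losses in the two applications of Fano's inequality. -/
noncomputable def fanoRemainder (c t : ℝ) : ℝ :=
  if t < 9 then 1 else 6 * Real.log 2 / c / t + 4 * Real.log 2 / Real.log t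

theorem tendsto_fanoRemainder (c : ℝ) : Tendsto (fanoRemainder c) atTop (𝓝 0) := by
  have h : Tendsto (fun t : ℝ => 6 * Real.log 2 / c / t + 4 * Real.log 2 / Real.log t) atTop
      (𝓝 (0 + 0)) :=
    (tendsto_const_nhds.div_atTop tendsto_id).add
      (tendsto_const_nhds.div_atTop Real.tendsto_log_atTop)
  rw [add_zero] at h
  refine h.congr' ?_
  filter_upwards [eventually_ge_atTop 9] with t ht
  rw [fanoRemainder, if_neg (not_lt.2 ht)]

/-- In terms of `y = λ d`, the first bound is at least of order `e^{y/12} / (y d)` and the second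
one at least `d² / y²`, so that `d` cancels in the square of the first times the second. -/
theorem exp_le_max_bounds {c h ℓ d lam : ℝ} (hc : 0 < c) (hch : c ≤ h) (hd : 3 ≤ d)
    (hlam : 0 < lam) (hℓ : 1 ≤ ℓ) :
    min 1 (c ^ 2 / (9 * 24 * 12 ^ 4)) * Real.exp (1 / 36 * (lam * d)) ≤
      max (Real.exp (lam * (d - 2) / 4) * h / (3 * lam * d ^ 2)) (ℓ / (lam * Real.tanh lam)) := by
  set y := lam * d with hy
  have hy0 : 0 < y := by positivity
  set K := min 1 (c ^ 2 / (9 * 24 * 12 ^ 4)) with hK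
  have hK0 : 0 < K := lt_min one_pos (by positivity)
  have hA1 : Real.exp (y / 12) * c / (3 * y * d) ≤
      Real.exp (lam * (d - 2) / 4) * h / (3 * lam * d ^ 2) := by
    have h1 : 3 * y * d = 3 * lam * d ^ 2 := by rw [hy]; ring
    have h2 : y / 12 ≤ lam * (d - 2) / 4 := by rw [hy]; nlinarith
    rw [h1]
    gcongr
  have hA2 : d ^ 2 / y ^ 2 ≤ ℓ / (lam * Real.tanh lam) := by
    have h1 : d ^ 2 / y ^ 2 = 1 / (lam * lam) := by
      rw [hy]
      field_simp
    have h2 := tanh_pos_of_pos hlam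
    have h3 := tanh_le_self_of_nonneg hlam.le
    rw [h1]
    gcongr
  by_contra! hlt
  obtain ⟨hlt1, hlt2⟩ := max_lt_iff.1 hlt
  have hb1 := hA1.trans_lt hlt1
  have hb2 := hA2.trans_lt hlt2
  have hprod : (Real.exp (y / 12) * c / (3 * y * d)) ^ 2 * (d ^ 2 / y ^ 2) <
      (K * Real.exp (1 / 36 * y)) ^ 2 * (K * Real.exp (1 / 36 * y)) := by
    have h1 : (0 : ℝ) < Real.exp (y / 12) * c / (3 * y * d) := by positivity
    exact mul_lt_mul'' (pow_lt_pow_left₀ hb1 h1.le two_ne_zero) hb2 (by positivity) (by positivity)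
  have hl : (Real.exp (y / 12) * c / (3 * y * d)) ^ 2 * (d ^ 2 / y ^ 2) =
      c ^ 2 / 9 * (Real.exp (y / 12) * Real.exp (y / 12)) / y ^ 4 := by
    field_simp
    norm_num
  have hr : (K * Real.exp (1 / 36 * y)) ^ 2 * (K * Real.exp (1 / 36 * y)) =
      K ^ 3 * Real.exp (y / 12) := by
    have : Real.exp (y / 12) = Real.exp (1 / 36 * y) ^ 3 := by
      rw [← Real.exp_nat_mul]
      congr 1
      push_cast
      ring
    rw [this]
    ring
  rw [hl, hr, div_lt_iff₀ (by positivity)] at hprod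
  have hpow := Real.pow_div_factorial_le_exp (y / 12) (by positivity) 4
  have hfac : ((Nat.factorial 4 : ℕ) : ℝ) = 24 := by norm_num [Nat.factorial]
  rw [hfac, div_pow, div_div, div_le_iff₀ (by positivity)] at hpow
  have hK3 : K ^ 3 * (9 * 24 * 12 ^ 4) ≤ c ^ 2 := by
    have h1 : K ^ 3 ≤ K := by
      simpa using pow_le_pow_of_le_one hK0.le (min_le_left _ _) (show 1 ≤ 3 by norm_num)
    have h2 : K ≤ c ^ 2 / (9 * 24 * 12 ^ 4) := min_le_right _ _
    rw [le_div_iff₀ (by positivity)] at h2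
    linarith
  have he := Real.exp_pos (y / 12)
  have h5 : K ^ 3 * Real.exp (y / 12) * y ^ 4 ≤
      K ^ 3 * Real.exp (y / 12) * (Real.exp (y / 12) * (12 ^ 4 * 24)) :=
    mul_le_mul_of_nonneg_left hpow (by positivity)
  have h6 : K ^ 3 * (9 * 24 * 12 ^ 4) * (Real.exp (y / 12) * Real.exp (y / 12)) ≤
      c ^ 2 * (Real.exp (y / 12) * Real.exp (y / 12)) :=
    mul_le_mul_of_nonneg_right hK3 (by positivity)
  linarith

theorem sample_bounds_with_remainder {p k d n : ℕ} {lam δ θ c : ℝ} {dec : Decoder n p} (hd : 2 < d)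
    (hk : 9 * d ^ 2 ≤ k) (hkp : 4 * k ≤ p) (hlam : 0 < lam) (hθ : 0 < θ)
    (hθd : θ < 1 / 4 * (((d : ℝ) - 2) / (d : ℝ))) (hc : 0 < c)
    (hch : c ≤ Real.log 2 - Real.binEntropy ((d : ℝ) / ((d : ℝ) - 2) * (2 * θ)))
    (hδ : worstErrProb k d lam ⌊θ * (k : ℝ)⌋₊ dec ≤ δ) :
    Real.exp (lam * ((d : ℝ) - 2) / 4) *
        (Real.log 2 - Real.binEntropy ((d : ℝ) / ((d : ℝ) - 2) * (2 * θ))) /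
        (3 * lam * (d : ℝ) ^ 2) * (1 - δ - fanoRemainder c ((k : ℝ) / (d : ℝ) ^ 2)) ≤ n ∧
      2 * (1 - θ) * Real.log (p : ℝ) / (lam * Real.tanh lam) *
        (1 - δ - fanoRemainder c ((k : ℝ) / (d : ℝ) ^ 2)) ≤ n ∧
      1 ≤ 2 * (1 - θ) * Real.log (p : ℝ) := by
  have hdR : (3 : ℝ) ≤ d := by exact_mod_cast hd
  have hd0 : (0 : ℝ) < d := by linarith
  have hkR : 9 * (d : ℝ) ^ 2 ≤ k := by exact_mod_cast hk
  have hd1 : (1 : ℝ) ≤ (d : ℝ) ^ 2 := by nlinarith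
  have hk0 : (0 : ℝ) < k := by linarith
  have hkpR : 4 * (k : ℝ) ≤ p := by exact_mod_cast hkp
  have hp0 : (0 : ℝ) < p := by linarith
  have hl2 : (1 / 2 : ℝ) < Real.log 2 := by linarith [Real.log_two_gt_d9]
  have hθ4 : θ < 1 / 4 := by
    refine hθd.trans_le ?_
    have : ((d : ℝ) - 2) / d ≤ 1 := by rw [div_le_one hd0]; linarith
    linarith
  have hp3 : 3 * Real.log 2 ≤ Real.log p := by
    rw [show (3 : ℝ) * Real.log 2 = ((3 : ℕ) : ℝ) * Real.log 2 by norm_num, ← Real.log_pow]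
    exact Real.log_le_log (by norm_num) (by linarith)
  set t := (k : ℝ) / (d : ℝ) ^ 2 with ht
  have ht9 : 9 ≤ t := by rwa [ht, le_div_iff₀ (by positivity)]
  have htk : t ≤ k := div_le_self hk0.le hd1
  have hlogt : 0 < Real.log t := Real.log_pos (by linarith)
  have htp : Real.log t ≤ Real.log p := Real.log_le_log (by linarith) (by linarith)
  set r := fanoRemainder c t with hr
  have hr_eq : r = 6 * Real.log 2 / c / t + 4 * Real.log 2 / Real.log t := by
    rw [hr, fanoRemainder, if_neg (not_lt.2 ht9)]
  have hr1 : 6 * Real.log 2 / c / t ≤ r := by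
    rw [hr_eq]
    exact le_add_of_nonneg_right (by positivity)
  have hr2 : 4 * Real.log 2 / Real.log t ≤ r := by
    rw [hr_eq]
    exact le_add_of_nonneg_left (by positivity)
  set h := Real.log 2 - Real.binEntropy ((d : ℝ) / ((d : ℝ) - 2) * (2 * θ))
  have htanh := tanh_pos_of_pos hlam
  have hprod : 3 / 4 * Real.log p ≤ (1 - θ) * Real.log p :=
    mul_le_mul_of_nonneg_right (by linarith) (by linarith)
  refine ⟨?_, ?_, by linarith⟩
  · have h1 := sample_bound_exp hd hk hkp hlam.le hθ hθd hδ
    have h2 : 6 * Real.log 2 / k ≤ h * r := by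
      calc 6 * Real.log 2 / k ≤ 6 * Real.log 2 / t := by gcongr
        _ = c * (6 * Real.log 2 / c / t) := by field_simp
        _ ≤ h * r := mul_le_mul hch hr1 (by positivity) (hc.le.trans hch)
    rw [div_mul_eq_mul_div, div_le_iff₀ (by positivity)]
    rw [Real.exp_neg] at h1
    set E := Real.exp (lam * ((d : ℝ) - 2) / 4)
    have hE : 0 < E := Real.exp_pos _
    have h3 : h * (1 - δ - r) ≤ n * (3 * lam * (d : ℝ) ^ 2 * E⁻¹) := by linarith
    calc E * h * (1 - δ - r) = E * (h * (1 - δ - r)) := by ring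
      _ ≤ E * (n * (3 * lam * (d : ℝ) ^ 2 * E⁻¹)) := mul_le_mul_of_nonneg_left h3 hE.le
      _ = n * (3 * lam * (d : ℝ) ^ 2) := by field_simp
  · have hk1 : 1 ≤ k := by exact_mod_cast hk0
    have h1 := sample_bound_of_matchings (by omega : 1 ≤ d) hk1 hkp hlam.le hθ.le
      (by linarith) hδ
    have h2 : 3 * Real.log 2 ≤ (1 - θ) * Real.log p * r := by
      calc 3 * Real.log 2 = 3 / 4 * Real.log t * (4 * Real.log 2 / Real.log t) := by
            field_simp
        _ ≤ (1 - θ) * Real.log p * r :=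
            mul_le_mul (by linarith) hr2 (by positivity) (by linarith)
    rw [div_mul_eq_mul_div, div_le_iff₀ (by positivity)]
    linarith

theorem theorem3 (θ : ℝ) (hθ : 0 < θ) :
    ∃ (r : ℝ → ℝ) (c C : ℝ), Tendsto r atTop (𝓝 0) ∧ 0 < c ∧ 0 < C ∧
      ∀ (p k d n : ℕ) (lam δ : ℝ) (dec : Decoder n p),
        2 < d → θ < 1 / 4 * (((d : ℝ) - 2) / (d : ℝ)) → (k : ℝ) ≤ (p : ℝ) / 4 → 0 < lam →
        worstErrProb k d lam ⌊θ * (k : ℝ)⌋₊ dec ≤ δ →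
          max
              (Real.exp (lam * ((d : ℝ) - 2) / 4) *
                  (Real.log 2 - Real.binEntropy ((d : ℝ) / ((d : ℝ) - 2) * (2 * θ))) /
                (3 * lam * (d : ℝ) ^ 2))
              (2 * (1 - θ) * Real.log (p : ℝ) / (lam * Real.tanh lam)) *
            (1 - δ - r ((k : ℝ) / (d : ℝ) ^ 2)) ≤ (n : ℝ) ∧
          C * Real.exp (c * (lam * (d : ℝ))) * (1 - δ - r ((k : ℝ) / (d : ℝ) ^ 2)) ≤ (n : ℝ) ∧
          ∀ B : ℝ, 0 < B → lam ≤ B / (d : ℝ) →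
            2 * (1 - θ) / B ^ 2 * ((d : ℝ) ^ 2 * Real.log (p : ℝ)) *
              (1 - δ - r ((k : ℝ) / (d : ℝ) ^ 2)) ≤ (n : ℝ) := by
  obtain ⟨c, hc, hgap⟩ := exists_entropy_gap hθ
  refine ⟨fanoRemainder c, 1 / 36, min 1 (c ^ 2 / (9 * 24 * 12 ^ 4)), tendsto_fanoRemainder c,
    by norm_num, lt_min one_pos (by positivity), ?_⟩
  intro p k d n lam δ dec hd hθd hkp hlam hδ
  have hch := hgap d hd hθd
  have hdR : (3 : ℝ) ≤ d := by exact_mod_cast hd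
  have hd0 : (0 : ℝ) < d := by linarith
  have hδ0 : 0 ≤ δ := (worstErrProb_nonneg _ _ _).trans hδ
  have hθ1 : θ < 1 := by
    refine hθd.trans_le ?_
    have : ((d : ℝ) - 2) / d ≤ 1 := by rw [div_le_one hd0]; linarith
    linarith
  have htanh := tanh_pos_of_pos hlam
  have hlogp : 0 ≤ Real.log (p : ℝ) := Real.log_natCast_nonneg p
  have h1θ : 0 ≤ 1 - θ := by linarith
  set t := (k : ℝ) / (d : ℝ) ^ 2 with ht
  have hA2 : 0 ≤ 2 * (1 - θ) * Real.log (p : ℝ) / (lam * Real.tanh lam) := by positivity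
  -- Where the last factor is not positive, all of the bounds are void.
  rcases le_or_gt (1 - δ - fanoRemainder c t) 0 with hneg | hpos
  · have hn : (0 : ℝ) ≤ n := Nat.cast_nonneg n
    refine ⟨(mul_nonpos_of_nonneg_of_nonpos (le_max_of_le_right hA2) hneg).trans hn,
      (mul_nonpos_of_nonneg_of_nonpos ?_ hneg).trans hn,
      fun B hB _ => (mul_nonpos_of_nonneg_of_nonpos ?_ hneg).trans hn⟩
    · exact mul_nonneg (lt_min one_pos (by positivity)).le (Real.exp_pos _).le
    · positivity
  have ht9 : 9 ≤ t := by
    by_contra! hlt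
    rw [fanoRemainder, if_pos hlt] at hpos
    linarith
  have hk : 9 * d ^ 2 ≤ k := by
    rw [ht, le_div_iff₀ (by positivity)] at ht9
    exact_mod_cast ht9
  have hkp' : 4 * k ≤ p := by
    rw [le_div_iff₀ (by norm_num)] at hkp
    rw [mul_comm]
    exact_mod_cast hkp
  obtain ⟨hb1, hb2, hℓ⟩ := sample_bounds_with_remainder hd hk hkp' hlam hθ hθd hc hch hδ
  have hmax := max_le hb1 hb2
  rw [← max_mul_of_nonneg _ _ hpos.le] at hmax
  refine ⟨hmax, ?_, fun B hB hlB => ?_⟩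
  · refine le_trans (mul_le_mul_of_nonneg_right ?_ hpos.le) hmax
    exact exp_le_max_bounds hc hch hdR hlam hℓ
  · refine le_trans (mul_le_mul_of_nonneg_right ?_ hpos.le) hb2
    have h1 : lam * Real.tanh lam ≤ (B / d) ^ 2 := by
      rw [sq]
      exact mul_le_mul hlB ((tanh_le_self_of_nonneg hlam.le).trans hlB) htanh.le (by positivity)
    calc 2 * (1 - θ) / B ^ 2 * ((d : ℝ) ^ 2 * Real.log (p : ℝ))
        = 2 * (1 - θ) * Real.log (p : ℝ) / (B / d) ^ 2 := by field_simp
      _ ≤ _ := by gcongr
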